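/- For $n\ge 1$, an input $y\in\mathbb{R}^n$ and weights $\alpha_1,\dots,\alpha_{n-1}\ge 0$, let $x^*(\gamma)$, $\gamma\ge 0$, be the unique minimizer over $x\in\mathbb{R}^n$ of $$\frac12\sum_{t=1}^n (x_t-y_t)^2+\gamma\sum_{t=1}^{n-1}\alpha_t\,|x_{t+1}-x_t|$$ (the weighted 1-D fused lasso, W1FL). The solution path $\gamma\mapsto x^*(\gamma)$ on $[0,\infty)$ is continuous and piecewise linear with finitely many linear segments; their number is one plus the number of $\gamma>0$ near which $x^*$ is not affine. A fuse (respectively un-fuse) event is a pair $(t,\gamma)$ with $1\le t\le n-1$ and $\gamma>0$ such that, as the parameter increases through $\gamma$, $x^*_{t+1}-x^*_t$ goes from non-zero to zero (respectively from zero to non-zero). Put $\tilde\alpha_1=\tilde\alpha_{n+1}=0$, $\tilde\alpha_{i+1}=\alpha_i$ for $1\le i\le n-1$, and $\tilde y_i=-\sum_{t=i}^n y_t$ for $1\le i\le n+1$ (so $\tilde y_{n+1}=0$). Theorem. There are a constant $c>0$ and an integer $N$ such that for every $n\ge N$ there exist weights $\alpha\ge 0$ and an input $y$ for which the W1FL solution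 path has at least $cn^2$ linear segments, at least $cn^2$ fuse events and at least $cn^2$ un-fuse events. Explicitly, this holds for the $\alpha$ and $y$ determined by $$\tilde\alpha_i=(i-1)^2\ (1\le i\le n),\quad \tilde\alpha_{n+1}=0,\qquad \tilde y_i=(-1)^i q_i\ (1\le i\le n),\quad \tilde y_{n+1}=0,$$ where $q_1=1$, $q_2=2$, $q_{i+2}=2q_{i+1}-q_i+2g_{i+2}+1$ for $i\ge 1$, and $g_3=1/3$, $g_{i+3}=2g_{i+2}+1$ for $i\ge 1$. -/

import Mathlib

open Filter Topology

namespace WeightedFusedLasso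

noncomputable section

/-- The objective of the weighted one-dimensional fused lasso in dimension `n = m + 1`, with weights
`α`, input `y` and parameter `γ`:
`(1/2) ∑_{t=1}^{n} (x_t - y_t)^2 + γ ∑_{t=1}^{n-1} α_t |x_{t+1} - x_t|`.
Indices start at `0`: the coordinate `x_t` is `x ⟨t - 1, _⟩`, and likewise for `α` and `y`. -/
def objective {m : ℕ} (α : Fin m → ℝ) (y : Fin (m + 1) → ℝ) (γ : ℝ) (x : Fin (m + 1) → ℝ) : ℝ :=
  (1 / 2) * ∑ t : Fin (m + 1), (x t - y t) ^ 2
    + γ * ∑ t : Fin m, α t * |x t.succ - x t.castSucc|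

/-- `x` solves the weighted fused lasso problem. -/
def IsSolution {m : ℕ} (α : Fin m → ℝ) (y : Fin (m + 1) → ℝ) (γ : ℝ) (x : Fin (m + 1) → ℝ) : Prop :=
  ∀ z : Fin (m + 1) → ℝ, objective α y γ x ≤ objective α y γ z

/-- The solution path `γ ↦ x*(γ)`; only the values at `γ ≥ 0` are meaningful. It is characterised by
`isSolution_iff_eq_solutionPath`. -/
def solutionPath {m : ℕ} (α : Fin m → ℝ) (y : Fin (m + 1) → ℝ) (γ : ℝ) : Fin (m + 1) → ℝ :=
  Classical.epsilon (IsSolution α y γ)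

theorem continuous_objective {m : ℕ} (α : Fin m → ℝ) (y : Fin (m + 1) → ℝ) (γ : ℝ) :
    Continuous (objective α y γ) := by
  unfold objective
  fun_prop

theorem exists_isSolution {m : ℕ} (α : Fin m → ℝ) (hα : ∀ t, 0 ≤ α t) (y : Fin (m + 1) → ℝ)
    {γ : ℝ} (hγ : 0 ≤ γ) : ∃ x, IsSolution α y γ x := by
  refine (continuous_objective α y γ).exists_forall_le' y ?_
  set C := objective α y γ y with hC
  have hcpt : IsCompact (Metric.closedBall y (2 * |C| + 1)) := isCompact_closedBall _ _
  filter_upwards [hcpt.compl_mem_cocompact] with z hz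
  have hz' : 2 * |C| + 1 < ‖z - y‖ := by
    simpa [Metric.mem_closedBall, dist_eq_norm] using hz
  have h1 : ‖z - y‖ ^ 2 ≤ ∑ t, (z t - y t) ^ 2 := by
    obtain ⟨t, -, ht⟩ := Finset.exists_mem_eq_sup' (Finset.univ_nonempty (α := Fin (m + 1)))
      (fun t => ‖(z - y) t‖)
    have h2 : ‖z - y‖ ≤ ‖(z - y) t‖ := by
      refine (pi_norm_le_iff_of_nonneg (norm_nonneg _)).2 fun i => ?_
      rw [← ht]
      exact Finset.le_sup' (fun t => ‖(z - y) t‖) (Finset.mem_univ i)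
    calc ‖z - y‖ ^ 2 ≤ ‖(z - y) t‖ ^ 2 := by gcongr
      _ = (z t - y t) ^ 2 := by simp [Real.norm_eq_abs]
      _ ≤ _ := Finset.single_le_sum (f := fun t => (z t - y t) ^ 2)
        (fun i _ => sq_nonneg _) (Finset.mem_univ t)
  have h3 : 0 ≤ γ * ∑ t : Fin m, α t * |z t.succ - z t.castSucc| :=
    mul_nonneg hγ (Finset.sum_nonneg fun t _ => mul_nonneg (hα t) (abs_nonneg _))
  have h4 : C ≤ |C| := le_abs_self C
  have h5 : 0 ≤ |C| := abs_nonneg C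
  unfold objective
  nlinarith

theorem isSolution_unique {m : ℕ} (α : Fin m → ℝ) (hα : ∀ t, 0 ≤ α t) (y : Fin (m + 1) → ℝ)
    {γ : ℝ} (hγ : 0 ≤ γ) {x z : Fin (m + 1) → ℝ} (hx : IsSolution α y γ x)
    (hz : IsSolution α y γ z) : x = z := by
  have hmid := hx (fun t => (x t + z t) / 2)
  have hxz := hz x
  unfold objective at hmid hxz
  have h1 : ∑ t, ((x t + z t) / 2 - y t) ^ 2 = (∑ t, (x t - y t) ^ 2) / 2
      + (∑ t, (z t - y t) ^ 2) / 2 - (∑ t, (x t - z t) ^ 2) / 4 := by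
    rw [Finset.sum_div, Finset.sum_div, Finset.sum_div, ← Finset.sum_add_distrib,
      ← Finset.sum_sub_distrib]
    exact Finset.sum_congr rfl fun t _ => by ring
  have h2 : ∑ t : Fin m, α t * |(x t.succ + z t.succ) / 2 - (x t.castSucc + z t.castSucc) / 2|
      ≤ (∑ t : Fin m, α t * |x t.succ - x t.castSucc|) / 2
        + (∑ t : Fin m, α t * |z t.succ - z t.castSucc|) / 2 := by
    rw [Finset.sum_div, Finset.sum_div, ← Finset.sum_add_distrib]
    refine Finset.sum_le_sum fun t _ => ?_
    have h3 : |(x t.succ + z t.succ) / 2 - (x t.castSucc + z t.castSucc) / 2|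
        ≤ |x t.succ - x t.castSucc| / 2 + |z t.succ - z t.castSucc| / 2 := by
      rw [abs_le]
      constructor
      · linarith [neg_abs_le (x t.succ - x t.castSucc), neg_abs_le (z t.succ - z t.castSucc)]
      · linarith [le_abs_self (x t.succ - x t.castSucc), le_abs_self (z t.succ - z t.castSucc)]
    nlinarith [mul_le_mul_of_nonneg_left h3 (hα t)]
  have h4 := mul_le_mul_of_nonneg_left h2 hγ
  have h5 : ∑ t, (x t - z t) ^ 2 ≤ 0 := by
    have h6 := hx z
    unfold objective at h6
    rw [h1] at hmid
    nlinarith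
  have h7 : ∑ t, (x t - z t) ^ 2 = 0 :=
    le_antisymm h5 (Finset.sum_nonneg fun t _ => sq_nonneg _)
  funext t
  have h8 := (Finset.sum_eq_zero_iff_of_nonneg (fun t _ => sq_nonneg (x t - z t))).1 h7 t
    (Finset.mem_univ t)
  exact sub_eq_zero.1 (pow_eq_zero_iff (two_ne_zero)|>.1 h8)

/-- For nonnegative weights and `γ ≥ 0`, the path gives the one and only solution. -/
theorem isSolution_iff_eq_solutionPath {m : ℕ} (α : Fin m → ℝ) (hα : ∀ t, 0 ≤ α t)
    (y : Fin (m + 1) → ℝ) {γ : ℝ} (hγ : 0 ≤ γ) (x : Fin (m + 1) → ℝ) :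
    IsSolution α y γ x ↔ x = solutionPath α y γ := by
  have h : IsSolution α y γ (solutionPath α y γ) :=
    Classical.epsilon_spec (exists_isSolution α hα y hγ)
  exact ⟨fun hx => isSolution_unique α hα y hγ hx h, fun hx => hx ▸ h⟩

/-- The critical values of a path `f` defined for `γ ≥ 0`: the `γ > 0` near which `f` is not given
by a single affine function, that is, where `f` changes linear segment. -/
def criticalValues {n : ℕ} (f : ℝ → Fin n → ℝ) : Set ℝ :=
  {γ | 0 < γ ∧ ¬ ∃ a b : Fin n → ℝ, ∀ᶠ s in 𝓝 γ, f s = a + s • b}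

/-- The number of linear segments on `[0, ∞)` of a continuous piecewise linear path: one more than
the number of its critical values. (`Set.ncard` is `0` on infinite sets, so that a lower bound
larger than `1` also says that the number is finite.) -/
def segmentCount {n : ℕ} (f : ℝ → Fin n → ℝ) : ℕ :=
  (criticalValues f).ncard + 1

/-- The fuse events `(t, γ)`: as the parameter increases through `γ > 0`, the difference of the
consecutive components `t` and `t + 1` goes from non-zero to zero. -/
def fuseEvents {m : ℕ} (f : ℝ → Fin (m + 1) → ℝ) : Set (Fin m × ℝ) :=
  {p | 0 < p.2 ∧ (∀ᶠ s in 𝓝[<] p.2, f s p.1.succ ≠ f s p.1.castSucc) ∧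
    ∀ᶠ s in 𝓝[≥] p.2, f s p.1.succ = f s p.1.castSucc}

/-- The un-fuse events `(t, γ)`: as the parameter increases through `γ > 0`, the difference of the
consecutive components `t` and `t + 1` goes from zero to non-zero. -/
def unfuseEvents {m : ℕ} (f : ℝ → Fin (m + 1) → ℝ) : Set (Fin m × ℝ) :=
  {p | 0 < p.2 ∧ (∀ᶠ s in 𝓝[≤] p.2, f s p.1.succ = f s p.1.castSucc) ∧
    ∀ᶠ s in 𝓝[>] p.2, f s p.1.succ ≠ f s p.1.castSucc}

/-- The extended weights `(α̃_1, …, α̃_{n+1}) = (0, α_1, …, α_{n-1}, 0)`, where `n = m + 1`;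
`α̃_i` is the entry at position `i - 1`. -/
def tildeWeights {m : ℕ} (α : Fin m → ℝ) : Fin (m + 2) → ℝ :=
  Fin.cons 0 (Fin.snoc α 0 : Fin (m + 1) → ℝ)

/-- The negated tail sums `ỹ_i = - ∑_{t=i}^{n} y_t`, `1 ≤ i ≤ n + 1`, where `n = m + 1`; `ỹ_i` is
the entry at position `i - 1`. -/
def tildeInput {m : ℕ} (y : Fin (m + 1) → ℝ) (i : Fin (m + 2)) : ℝ :=
  - ∑ t : Fin (m + 1), if i ≤ t.castSucc then y t else 0

/-- `g_3 = 1/3` and `g_{i+1} = 2 g_i + 1` for `i ≥ 3`; the values at `0, 1, 2` are not used. -/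
def g : ℕ → ℝ
  | 0 => 0
  | 1 => 0
  | 2 => 0
  | 3 => 1 / 3
  | i + 4 => 2 * g (i + 3) + 1

/-- `q_1 = 1`, `q_2 = 2` and `q_{i+2} = 2 q_{i+1} - q_i + 2 g_{i+2} + 1` for `i ≥ 1`; the value at
`0` is not used. -/
def q : ℕ → ℝ
  | 0 => 0
  | 1 => 1
  | 2 => 2
  | i + 3 => 2 * q (i + 2) - q (i + 1) + 2 * g (i + 3) + 1

end

end WeightedFusedLasso

/-! In terms of partial sums the problem is a taut string problem. The string X has prescribed ends,
stays within γ α̃_j of ỹ_j, and bends only where it touches the tube: upwards at the upper end,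
downwards at the lower end (`isSolution_of_string`). The jumps of the solution are the bends of the
string.

The centers alternate in sign and grow like (4/3) 2^j, while the radii γ (j-1)^2 grow quadratically.
For γ near (4/3) 2^K / K^2 the tube at every j ≥ K lies on one side of 0, and the string zigzags
between its inner ends. Far below K the centers are negligible, and after reflection by (-1)^K the
upper end is nearly the convex parabola γ (j-1)^2. The string follows this upper end up to a contact
p, then runs straight to the pivot, the lower end of the tube at K (`isPhase_of_mem_Icc`).

As γ grows, the pivot sinks and the parabola steepens, so p decreases one by one from about K/32,
with a fuse event at each `threshold`. Passing to pivot K+1 roughly doubles γ and reflects the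
picture: the contact starts again at about K/32 on the other side of the tube, so every index
released in phase K un-fuses in between (`exists_unfuseEvent`).

Order n pivots with order n indices each give order n^2 events. The thresholds are all distinct
(`eq_of_threshold_eq`), and for a fixed index the un-fuse windows of different pivots are disjoint.
Every event time is critical, and critical values are finite in number because the solution is
affine while its sign pattern is constant (`finite_criticalValues`). -/

namespace WeightedFusedLasso

/-! ### First order conditions, piecewise linearity and continuity of the path. -/

section Optimality

variable {m : ℕ}

/-- The jump of `x` between consecutive coordinates. -/
def jump (x : Fin (m + 1) → ℝ) (t : Fin m) : ℝ := x t.succ - x t.castSucc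

/-- The one-sided derivative of `a ↦ |a|` at a point of sign `s` in the direction `v`. -/
noncomputable def absDeriv (s : SignType) (v : ℝ) : ℝ := if s = 0 then |v| else (s : ℝ) * v

theorem absDeriv_sign_le (a b : ℝ) : absDeriv (SignType.sign a) (b - a) ≤ |b| - |a| := by
  unfold absDeriv
  rcases lt_trichotomy a 0 with h | h | h
  · simp only [sign_neg h, abs_of_neg h]
    simp
    linarith [neg_abs_le b]
  · simp [h]
  · simp only [sign_pos h, abs_of_pos h]
    simp
    linarith [le_abs_self b]

theorem eventually_abs_add_mul (a v : ℝ) :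
    ∀ᶠ e in 𝓝[>] (0 : ℝ), |a + e * v| = |a| + e * absDeriv (SignType.sign a) v := by
  have hc : Tendsto (fun e : ℝ => a + e * v) (𝓝[>] 0) (𝓝 a) := by
    have : Continuous fun e : ℝ => a + e * v := by fun_prop
    have h := this.tendsto 0
    simp only [zero_mul, add_zero] at h
    exact h.mono_left nhdsWithin_le_nhds
  unfold absDeriv
  rcases lt_trichotomy a 0 with h | h | h
  · filter_upwards [hc.eventually (gt_mem_nhds h)] with e he
    simp only [sign_neg h, abs_of_neg h, abs_of_neg he]
    simp
    ring
  · filter_upwards [self_mem_nhdsWithin] with e he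
    simp [h, abs_mul, abs_of_pos (show (0 : ℝ) < e from he)]
  · filter_upwards [hc.eventually (lt_mem_nhds h)] with e he
    simp only [sign_pos h, abs_of_pos h, abs_of_pos he]
    simp

/-- The first order condition for a point `x` whose jumps have the signs `σ`. -/
def FirstOrder (α : Fin m → ℝ) (y : Fin (m + 1) → ℝ) (σ : Fin m → SignType) (γ : ℝ)
    (x : Fin (m + 1) → ℝ) : Prop :=
  ∀ v : Fin (m + 1) → ℝ,
    0 ≤ ∑ t, (x t - y t) * v t + γ * ∑ t, α t * absDeriv (σ t) (jump v t)

theorem IsSolution.firstOrder {α : Fin m → ℝ} {y : Fin (m + 1) → ℝ} {γ : ℝ}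
    {x : Fin (m + 1) → ℝ} (hx : IsSolution α y γ x) :
    FirstOrder α y (fun t => SignType.sign (jump x t)) γ x := by
  intro v
  set L := ∑ t, (x t - y t) * v t
    + γ * ∑ t, α t * absDeriv (SignType.sign (jump x t)) (jump v t) with hL
  have h1 : ∀ᶠ e in 𝓝[>] (0 : ℝ), ∀ t : Fin m, |jump x t + e * jump v t|
      = |jump x t| + e * absDeriv (SignType.sign (jump x t)) (jump v t) :=
    eventually_all.2 fun t => eventually_abs_add_mul _ _
  have h2 : ∀ᶠ e in 𝓝[>] (0 : ℝ), 0 ≤ L + e * ((1 / 2) * ∑ t, v t ^ 2) := by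
    filter_upwards [h1, self_mem_nhdsWithin] with e he hpos
    have hpos : (0 : ℝ) < e := hpos
    have h3 := hx (fun t => x t + e * v t)
    unfold objective at h3
    have h4 : ∑ t, (x t + e * v t - y t) ^ 2 = ∑ t, (x t - y t) ^ 2
        + 2 * e * ∑ t, (x t - y t) * v t + e ^ 2 * ∑ t, v t ^ 2 := by
      rw [Finset.mul_sum, Finset.mul_sum, ← Finset.sum_add_distrib, ← Finset.sum_add_distrib]
      exact Finset.sum_congr rfl fun t _ => by ring
    have h5 : ∑ t : Fin m, α t * |x t.succ + e * v t.succ - (x t.castSucc + e * v t.castSucc)|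
        = ∑ t : Fin m, α t * |x t.succ - x t.castSucc|
          + e * ∑ t, α t * absDeriv (SignType.sign (jump x t)) (jump v t) := by
      rw [Finset.mul_sum, ← Finset.sum_add_distrib]
      refine Finset.sum_congr rfl fun t _ => ?_
      have h6 := he t
      have h7 : x t.succ + e * v t.succ - (x t.castSucc + e * v t.castSucc)
          = jump x t + e * jump v t := by unfold jump; ring
      rw [h7, h6, jump]
      ring
    rw [h4, h5] at h3
    have h8 : 0 ≤ e * (L + e * ((1 / 2) * ∑ t, v t ^ 2)) := by
      rw [hL]; linarith
    exact nonneg_of_mul_nonneg_right h8 hpos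
  have h3 : Tendsto (fun e : ℝ => L + e * ((1 / 2) * ∑ t, v t ^ 2)) (𝓝[>] 0) (𝓝 L) := by
    have : Continuous fun e : ℝ => L + e * ((1 / 2) * ∑ t, v t ^ 2) := by fun_prop
    have h := this.tendsto 0
    simp only [zero_mul, add_zero] at h
    exact h.mono_left nhdsWithin_le_nhds
  exact ge_of_tendsto h3 h2

theorem FirstOrder.add_le {α : Fin m → ℝ} (hα : ∀ t, 0 ≤ α t) {y : Fin (m + 1) → ℝ} {γ : ℝ}
    (hγ : 0 ≤ γ) {x : Fin (m + 1) → ℝ}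
    (hx : FirstOrder α y (fun t => SignType.sign (jump x t)) γ x) (z : Fin (m + 1) → ℝ) :
    0 ≤ ∑ t, (x t - y t) * (z t - x t)
      + γ * (∑ t, α t * |jump z t| - ∑ t, α t * |jump x t|) := by
  refine (hx (fun t => z t - x t)).trans ?_
  rw [← Finset.sum_sub_distrib]
  gcongr with t
  rw [← mul_sub]
  refine mul_le_mul_of_nonneg_left ?_ (hα t)
  have h : jump (fun t => z t - x t) t = jump z t - jump x t := by unfold jump; ring
  rw [h]
  exact absDeriv_sign_le _ _

theorem FirstOrder.isSolution {α : Fin m → ℝ} (hα : ∀ t, 0 ≤ α t) {y : Fin (m + 1) → ℝ} {γ : ℝ}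
    (hγ : 0 ≤ γ) {x : Fin (m + 1) → ℝ}
    (hx : FirstOrder α y (fun t => SignType.sign (jump x t)) γ x) : IsSolution α y γ x := by
  intro z
  have h1 := hx.add_le hα hγ z
  have h2 : ∑ t, (z t - y t) ^ 2 = ∑ t, (x t - y t) ^ 2
      + 2 * ∑ t, (x t - y t) * (z t - x t) + ∑ t, (z t - x t) ^ 2 := by
    rw [Finset.mul_sum, ← Finset.sum_add_distrib, ← Finset.sum_add_distrib]
    exact Finset.sum_congr rfl fun t _ => by ring
  have h3 : 0 ≤ ∑ t, (z t - x t) ^ 2 := Finset.sum_nonneg fun t _ => sq_nonneg _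
  unfold objective
  unfold jump at h1
  rw [h2]
  linarith

theorem isSolution_solutionPath {α : Fin m → ℝ} (hα : ∀ t, 0 ≤ α t) (y : Fin (m + 1) → ℝ) {γ : ℝ}
    (hγ : 0 ≤ γ) : IsSolution α y γ (solutionPath α y γ) :=
  (isSolution_iff_eq_solutionPath α hα y hγ _).2 rfl

/-- The parameters at which the jumps of the solution have the signs `σ`. -/
def signCell (α : Fin m → ℝ) (y : Fin (m + 1) → ℝ) (σ : Fin m → SignType) : Set ℝ :=
  {γ | 0 ≤ γ ∧ (fun t => SignType.sign (jump (solutionPath α y γ) t)) = σ}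

theorem sign_convex_combination {a b p r : ℝ} (hp : 0 ≤ p) (hr : 0 ≤ r) (hpr : p + r = 1)
    (h : SignType.sign a = SignType.sign b) :
    SignType.sign (p * a + r * b) = SignType.sign a := by
  rcases lt_trichotomy a 0 with ha | ha | ha
  · rw [sign_neg ha] at h ⊢
    have hb : b < 0 := sign_eq_neg_one_iff.1 h.symm
    apply sign_neg
    rcases hp.eq_or_lt with rfl | hp
    · simp only [zero_add] at hpr; subst hpr; linarith
    · nlinarith [mul_neg_of_pos_of_neg hp ha]
  · subst ha
    rw [sign_zero] at h ⊢
    simp [sign_eq_zero_iff.1 h.symm]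
  · rw [sign_pos ha] at h ⊢
    have hb : 0 < b := sign_eq_one_iff.1 h.symm
    apply sign_pos
    rcases hp.eq_or_lt with rfl | hp
    · simp only [zero_add] at hpr; subst hpr; linarith
    · nlinarith [mul_pos hp ha]

/-- For a fixed sign pattern the first order condition is jointly affine in the parameter and the
point, so it passes to convex combinations, which also keep the pattern. Uniqueness then identifies
the combination with the solution. -/
theorem signCell_convex_combination {α : Fin m → ℝ} (hα : ∀ t, 0 ≤ α t) {y : Fin (m + 1) → ℝ}
    {σ : Fin m → SignType} {γ₁ γ₂ p r : ℝ} (h₁ : γ₁ ∈ signCell α y σ) (h₂ : γ₂ ∈ signCell α y σ)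
    (hp : 0 ≤ p) (hr : 0 ≤ r) (hpr : p + r = 1) :
    p * γ₁ + r * γ₂ ∈ signCell α y σ ∧
      solutionPath α y (p * γ₁ + r * γ₂) = p • solutionPath α y γ₁ + r • solutionPath α y γ₂ := by
  obtain ⟨hγ₁, hσ₁⟩ := h₁
  obtain ⟨hγ₂, hσ₂⟩ := h₂
  set x₁ := solutionPath α y γ₁ with hx₁
  set x₂ := solutionPath α y γ₂ with hx₂
  have f₁ := (isSolution_solutionPath hα y hγ₁).firstOrder
  have f₂ := (isSolution_solutionPath hα y hγ₂).firstOrder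
  rw [← hx₁, hσ₁] at f₁
  rw [← hx₂, hσ₂] at f₂
  have hγ : 0 ≤ p * γ₁ + r * γ₂ := by positivity
  set x := p • x₁ + r • x₂ with hx
  have hσ : (fun t => SignType.sign (jump x t)) = σ := by
    funext t
    have h : jump x t = p * jump x₁ t + r * jump x₂ t := by
      simp only [jump, hx, Pi.add_apply, Pi.smul_apply, smul_eq_mul]; ring
    rw [h, sign_convex_combination hp hr hpr, ← hσ₁]
    exact (congrFun hσ₁ t).trans (congrFun hσ₂ t).symm
  have hf : FirstOrder α y σ (p * γ₁ + r * γ₂) x := by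
    intro v
    have e₁ := mul_nonneg hp (f₁ v)
    have e₂ := mul_nonneg hr (f₂ v)
    have h : ∑ t, (x t - y t) * v t
        = p * ∑ t, (x₁ t - y t) * v t + r * ∑ t, (x₂ t - y t) * v t := by
      rw [Finset.mul_sum, Finset.mul_sum, ← Finset.sum_add_distrib]
      refine Finset.sum_congr rfl fun t _ => ?_
      have h : p = 1 - r := by linarith
      simp only [hx, Pi.add_apply, Pi.smul_apply, smul_eq_mul, h]; ring
    rw [h]
    linarith
  rw [← hσ] at hf
  have hs := (isSolution_iff_eq_solutionPath α hα y hγ x).1 (hf.isSolution hα hγ)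
  exact ⟨⟨hγ, by rw [← hs]; exact hσ⟩, hs.symm⟩

theorem ordConnected_signCell {α : Fin m → ℝ} (hα : ∀ t, 0 ≤ α t) (y : Fin (m + 1) → ℝ)
    (σ : Fin m → SignType) : (signCell α y σ).OrdConnected := by
  have h : Convex ℝ (signCell α y σ) := by
    intro a ha b hb p r hp hr hpr
    exact (signCell_convex_combination hα ha hb hp hr hpr).1
  exact h.ordConnected

theorem mem_signCell_self {α : Fin m → ℝ} {y : Fin (m + 1) → ℝ} {γ : ℝ} (hγ : 0 ≤ γ) :
    γ ∈ signCell α y (fun t => SignType.sign (jump (solutionPath α y γ) t)) := ⟨hγ, rfl⟩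

theorem exists_affine_on_Icc {α : Fin m → ℝ} (hα : ∀ t, 0 ≤ α t) {y : Fin (m + 1) → ℝ}
    {σ : Fin m → SignType} {a b : ℝ} (ha : a ∈ signCell α y σ) (hb : b ∈ signCell α y σ)
    (hab : a < b) : ∃ c d : Fin (m + 1) → ℝ, ∀ s ∈ Set.Icc a b, solutionPath α y s = c + s • d := by
  set A := solutionPath α y a with hA
  set B := solutionPath α y b with hB
  refine ⟨A - (a / (b - a)) • (B - A), (1 / (b - a)) • (B - A), fun s hs => ?_⟩
  have hba : 0 < b - a := sub_pos.2 hab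
  have h := (signCell_convex_combination hα ha hb (p := (b - s) / (b - a)) (r := (s - a) / (b - a))
    (div_nonneg (by linarith [hs.2]) hba.le) (div_nonneg (by linarith [hs.1]) hba.le)
    (by field_simp; ring)).2
  have hs' : (b - s) / (b - a) * a + (s - a) / (b - a) * b = s := by field_simp; ring
  rw [hs', ← hA, ← hB] at h
  rw [h]
  funext t
  simp only [Pi.add_apply, Pi.sub_apply, Pi.smul_apply, smul_eq_mul]
  field_simp
  ring

/-- There are finitely many sign cells, each an interval on which the path is affine, so only
endpoints of cells can be critical. -/
theorem finite_criticalValues {α : Fin m → ℝ} (hα : ∀ t, 0 ≤ α t) (y : Fin (m + 1) → ℝ) :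
    (criticalValues (solutionPath α y)).Finite := by
  refine (Set.finite_iUnion fun σ : Fin m → SignType =>
    Set.toFinite {sInf (signCell α y σ), sSup (signCell α y σ)}).subset ?_
  rintro γ ⟨hγ, hcrit⟩
  by_contra hne
  simp only [Set.mem_iUnion, not_exists, Set.mem_insert_iff, Set.mem_singleton_iff, not_or] at hne
  apply hcrit
  set σ : Fin m → SignType := fun t => SignType.sign (jump (solutionPath α y γ) t) with hσ
  have hmem : γ ∈ signCell α y σ := mem_signCell_self hγ.le
  obtain ⟨hinf, hsup⟩ := hne σ
  have hbdd : BddBelow (signCell α y σ) := ⟨0, fun s hs => hs.1⟩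
  obtain ⟨a, ha, haγ⟩ : ∃ a ∈ signCell α y σ, a < γ :=
    exists_lt_of_csInf_lt ⟨γ, hmem⟩ (lt_of_le_of_ne (csInf_le hbdd hmem) (Ne.symm hinf))
  obtain ⟨b, hb, hγb⟩ : ∃ b ∈ signCell α y σ, γ < b := by
    by_cases hab : BddAbove (signCell α y σ)
    · exact exists_lt_of_lt_csSup ⟨γ, hmem⟩ (lt_of_le_of_ne (le_csSup hab hmem) hsup)
    -- Here `sSup` has its default value, so `hsup` carries no information; unboundedness supplies
    -- the later point.
    · obtain ⟨b, hb, h⟩ := not_bddAbove_iff.1 hab γ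
      exact ⟨b, hb, h⟩
  obtain ⟨c, d, hcd⟩ := exists_affine_on_Icc hα ha hb (haγ.trans hγb)
  exact ⟨c, d, by filter_upwards [Icc_mem_nhds haγ hγb] with s hs using hcd s hs⟩

/-- Pigeonhole: one of the finitely many patterns recurs arbitrarily close to `e` on the right, and
order-connectedness of its cell fills the space between. -/
theorem exists_signCell_mem_nhdsGT {α : Fin m → ℝ} (hα : ∀ t, 0 ≤ α t) (y : Fin (m + 1) → ℝ)
    {e : ℝ} (he : 0 ≤ e) : ∃ σ, signCell α y σ ∈ 𝓝[>] e := by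
  have h1 : ∃ σ : Fin m → SignType, ∃ᶠ s in 𝓝[>] e, s ∈ signCell α y σ := by
    by_contra hcon
    simp only [not_exists, not_frequently] at hcon
    have h2 := eventually_all.2 hcon
    obtain ⟨s, hs, hes⟩ := (h2.and self_mem_nhdsWithin).exists
    exact hs _ (mem_signCell_self (he.trans (le_of_lt hes)))
  obtain ⟨σ, hσ⟩ := h1
  refine ⟨σ, ?_⟩
  obtain ⟨b, hb, heb⟩ := (hσ.and_eventually self_mem_nhdsWithin).exists
  have heb : e < b := heb
  filter_upwards [Ioo_mem_nhdsGT heb] with s hs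
  obtain ⟨a, ha, has⟩ := (hσ.and_eventually (Ioo_mem_nhdsGT hs.1)).exists
  exact (ordConnected_signCell hα y σ).out ha hb ⟨has.2.le, hs.2.le⟩

theorem eventually_jump_eq_zero_or_ne {α : Fin m → ℝ} (hα : ∀ t, 0 ≤ α t) (y : Fin (m + 1) → ℝ)
    {e : ℝ} (he : 0 ≤ e) (t : Fin m) :
    (∀ᶠ s in 𝓝[>] e, jump (solutionPath α y s) t = 0) ∨
      ∀ᶠ s in 𝓝[>] e, jump (solutionPath α y s) t ≠ 0 := by
  obtain ⟨σ, hσ⟩ := exists_signCell_mem_nhdsGT hα y he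
  by_cases h : σ t = 0
  · left
    filter_upwards [hσ] with s hs
    exact sign_eq_zero_iff.1 ((congrFun hs.2 t).trans h)
  · right
    filter_upwards [hσ] with s hs h0
    exact h ((congrFun hs.2 t).symm.trans (sign_eq_zero_iff.2 h0))

/-- Each solution is tested in the variational inequality of the other; in the sum `y` cancels and
the squares remain. -/
theorem sum_sq_solutionPath_sub_le {α : Fin m → ℝ} (hα : ∀ t, 0 ≤ α t) (y : Fin (m + 1) → ℝ)
    {γ γ' : ℝ} (hγ : 0 ≤ γ) (hγ' : 0 ≤ γ') :
    ∑ t, (solutionPath α y γ' t - solutionPath α y γ t) ^ 2 ≤ (γ - γ') *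
      (∑ t, α t * |jump (solutionPath α y γ') t| - ∑ t, α t * |jump (solutionPath α y γ) t|) := by
  set x := solutionPath α y γ with hx
  set x' := solutionPath α y γ' with hx'
  have h1 := (isSolution_solutionPath hα y hγ).firstOrder.add_le hα hγ x'
  have h2 := (isSolution_solutionPath hα y hγ').firstOrder.add_le hα hγ' x
  rw [← hx] at h1
  rw [← hx'] at h2
  have h3 : ∑ t, (x' t - x t) ^ 2
      = -(∑ t, (x t - y t) * (x' t - x t)) - ∑ t, (x' t - y t) * (x t - x' t) := by
    rw [← Finset.sum_neg_distrib, ← Finset.sum_sub_distrib]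
    exact Finset.sum_congr rfl fun t _ => by ring
  rw [h3]
  linarith

/-- The distance `D` enters quadratically on the left and linearly, through the change of total
variation, on the right; one factor cancels. -/
theorem lipschitz_solutionPath {α : Fin m → ℝ} (hα : ∀ t, 0 ≤ α t) (y : Fin (m + 1) → ℝ)
    {γ γ' : ℝ} (hγ : 0 ≤ γ) (hγ' : 0 ≤ γ') :
    ‖solutionPath α y γ' - solutionPath α y γ‖ ≤ (2 * ∑ t, α t) * |γ' - γ| := by
  set x := solutionPath α y γ with hx
  set x' := solutionPath α y γ' with hx'
  have h1 := sum_sq_solutionPath_sub_le hα y hγ hγ'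
  rw [← hx, ← hx'] at h1
  set D := ‖x' - x‖ with hD
  have hcoord : ∀ t, |x' t - x t| ≤ D := fun t => norm_le_pi_norm (x' - x) t
  have h2 : |(∑ t, α t * |jump x' t|) - (∑ t, α t * |jump x t|)| ≤ (2 * ∑ t, α t) * D := by
    rw [← Finset.sum_sub_distrib, Finset.mul_sum, Finset.sum_mul]
    refine (Finset.abs_sum_le_sum_abs _ _).trans (Finset.sum_le_sum fun t _ => ?_)
    rw [← mul_sub, abs_mul, abs_of_nonneg (hα t)]
    have h3 : |(|jump x' t| - |jump x t|)| ≤ 2 * D := by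
      refine (abs_abs_sub_abs_le_abs_sub _ _).trans ?_
      have h4 : jump x' t - jump x t
          = (x' t.succ - x t.succ) - (x' t.castSucc - x t.castSucc) := by unfold jump; ring
      rw [h4]
      refine (abs_sub _ _).trans ?_
      linarith [hcoord t.succ, hcoord t.castSucc]
    nlinarith [mul_le_mul_of_nonneg_left h3 (hα t)]
  have h5 : D ^ 2 ≤ ∑ t, (x' t - x t) ^ 2 := by
    obtain ⟨t, -, ht⟩ := Finset.exists_mem_eq_sup' (Finset.univ_nonempty (α := Fin (m + 1)))
      (fun t => ‖(x' - x) t‖)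
    have h6 : D ≤ ‖(x' - x) t‖ := by
      refine (pi_norm_le_iff_of_nonneg (norm_nonneg _)).2 fun i => ?_
      rw [← ht]
      exact Finset.le_sup' (fun t => ‖(x' - x) t‖) (Finset.mem_univ i)
    calc D ^ 2 ≤ ‖(x' - x) t‖ ^ 2 := by gcongr
      _ = (x' t - x t) ^ 2 := by simp [Real.norm_eq_abs]
      _ ≤ _ := Finset.single_le_sum (f := fun t => (x' t - x t) ^ 2)
        (fun i _ => sq_nonneg _) (Finset.mem_univ t)
  have h6 : D * D ≤ ((2 * ∑ t, α t) * |γ' - γ|) * D := by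
    calc D * D = D ^ 2 := by ring
      _ ≤ _ := h5.trans h1
      _ ≤ |(γ - γ') * (∑ t, α t * |jump x' t| - ∑ t, α t * |jump x t|)| := le_abs_self _
      _ = |γ' - γ| * |(∑ t, α t * |jump x' t|) - (∑ t, α t * |jump x t|)| := by
        rw [abs_mul, abs_sub_comm]
      _ ≤ |γ' - γ| * ((2 * ∑ t, α t) * D) := by gcongr
      _ = _ := by ring
  rcases (norm_nonneg (x' - x)).eq_or_lt with h0 | h0
  · rw [hD, ← h0]
    have : 0 ≤ ∑ t, α t := Finset.sum_nonneg fun t _ => hα t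
    positivity
  · exact le_of_mul_le_mul_right h6 h0

theorem continuousOn_solutionPath {α : Fin m → ℝ} (hα : ∀ t, 0 ≤ α t) (y : Fin (m + 1) → ℝ) :
    ContinuousOn (solutionPath α y) (Set.Ici 0) := by
  have h : LipschitzOnWith (2 * ∑ t, α t).toNNReal (solutionPath α y) (Set.Ici 0) := by
    refine LipschitzOnWith.of_dist_le_mul fun a ha b hb => ?_
    rw [dist_eq_norm, Real.dist_eq, Real.coe_toNNReal _
      (mul_nonneg zero_le_two (Finset.sum_nonneg fun t _ => hα t))]
    exact lipschitz_solutionPath hα y hb ha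
  exact h.continuousOn

theorem continuousOn_jump_solutionPath {α : Fin m → ℝ} (hα : ∀ t, 0 ≤ α t) (y : Fin (m + 1) → ℝ)
    (t : Fin m) : ContinuousOn (fun γ => jump (solutionPath α y γ) t) (Set.Ici 0) := by
  have h := continuousOn_pi.1 (continuousOn_solutionPath hα y)
  exact (h _).sub (h _)

/-- A jump that vanishes on an interval and not at a later parameter un-fuses in between. -/
theorem exists_unfuseEvent {α : Fin m → ℝ} (hα : ∀ t, 0 ≤ α t) (y : Fin (m + 1) → ℝ)
    {a b c : ℝ} (ha : 0 ≤ a) (hab : a < b) (hbc : b ≤ c) (t : Fin m)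
    (h0 : ∀ s ∈ Set.Icc a b, jump (solutionPath α y s) t = 0)
    (hc : jump (solutionPath α y c) t ≠ 0) :
    ∃ e, b ≤ e ∧ e < c ∧ (t, e) ∈ unfuseEvents (solutionPath α y) := by
  set d : ℝ → ℝ := fun s => jump (solutionPath α y s) t with hd
  have hcont : ContinuousOn d (Set.Ici 0) := continuousOn_jump_solutionPath hα y t
  -- The event is the last time up to which the jump has vanished without interruption since `a`.
  set A : Set ℝ := {s | s ∈ Set.Icc b c ∧ ∀ r ∈ Set.Icc a s, d r = 0} with hA
  have hbA : b ∈ A := ⟨⟨le_rfl, hbc⟩, h0⟩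
  have hbdd : BddAbove A := ⟨c, fun s hs => hs.1.2⟩
  set e := sSup A with he
  have hbe : b ≤ e := le_csSup hbdd hbA
  have hec : e ≤ c := csSup_le ⟨b, hbA⟩ fun s hs => hs.1.2
  have hlt : ∀ r, a ≤ r → r < e → d r = 0 := by
    intro r har hre
    obtain ⟨s, hs, hrs⟩ := exists_lt_of_lt_csSup ⟨b, hbA⟩ hre
    exact hs.2 r ⟨har, hrs.le⟩
  have hae : a < e := hab.trans_le hbe
  have he0 : d e = 0 := by
    have h1 : Tendsto d (𝓝[<] e) (𝓝 (d e)) :=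
      ((hcont.continuousAt (Ici_mem_nhds (ha.trans_lt hae))).tendsto).mono_left nhdsWithin_le_nhds
    have h2 : Tendsto d (𝓝[<] e) (𝓝 0) := by
      refine tendsto_const_nhds.congr' ?_
      filter_upwards [Ioo_mem_nhdsLT hae] with s hs using (hlt s hs.1.le hs.2).symm
    exact tendsto_nhds_unique h1 h2
  have hle : ∀ r ∈ Set.Icc a e, d r = 0 := by
    rintro r ⟨har, hre⟩
    rcases hre.eq_or_lt with rfl | hre
    · exact he0
    · exact hlt r har hre
  have hec' : e < c := lt_of_le_of_ne hec fun h => hc (h ▸ he0)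
  refine ⟨e, hbe, hec', ha.trans_lt hae, ?_, ?_⟩
  · filter_upwards [Ioc_mem_nhdsLE hae] with s hs
    exact sub_eq_zero.1 (hle s ⟨hs.1.le, hs.2⟩)
  -- Just after `e` the jump cannot oscillate. If it stayed zero, `A` would extend beyond its
  -- supremum.
  · rcases eventually_jump_eq_zero_or_ne hα y (ha.trans hae.le) t with h | h
    · exfalso
      obtain ⟨u, hu, hsub⟩ := mem_nhdsGT_iff_exists_Ioo_subset.1 h
      have hu : e < u := hu
      obtain ⟨v, hev, hv⟩ := exists_between (lt_min hu hec')
      have hvA : v ∈ A := by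
        refine ⟨⟨hbe.trans hev.le, (hv.trans_le (min_le_right _ _)).le⟩, fun r hr => ?_⟩
        rcases le_or_gt r e with hre | hre
        · exact hle r ⟨hr.1, hre⟩
        · exact hsub ⟨hre, hr.2.trans_lt (hv.trans_le (min_le_left _ _))⟩
      exact absurd (le_csSup hbdd hvA) (not_le.2 hev)
    · filter_upwards [h] with s hs
      exact sub_ne_zero.1 hs

end Optimality

/-! ### Events are critical values. -/

section Events

variable {m : ℕ} {f : ℝ → Fin (m + 1) → ℝ}

/-- An affine difference that vanishes at a point and just after it vanishes just before it too. -/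
theorem fuseEvent_mem_criticalValues {p : Fin m × ℝ} (hp : p ∈ fuseEvents f) :
    p.2 ∈ criticalValues f := by
  obtain ⟨hpos, hl, hr⟩ := hp
  refine ⟨hpos, ?_⟩
  rintro ⟨a, b, hab⟩
  have h1 := (hr.filter_mono (nhdsWithin_mono _ Set.Ioi_subset_Ici_self)).and
    (hab.filter_mono nhdsWithin_le_nhds)
  obtain ⟨s, ⟨hs, hsa⟩, hps⟩ := (h1.and self_mem_nhdsWithin).exists
  have hps : p.2 < s := hps
  have h0 := hr.self_of_nhdsWithin Set.self_mem_Ici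
  obtain ⟨r, hr, hra⟩ := (hl.and (hab.filter_mono nhdsWithin_le_nhds)).exists
  rw [hsa] at hs
  rw [hab.self_of_nhds] at h0
  rw [hra] at hr
  simp only [Pi.add_apply, Pi.smul_apply, smul_eq_mul] at hs h0 hr
  have hb : b p.1.succ = b p.1.castSucc := by
    have : (s - p.2) * (b p.1.succ - b p.1.castSucc) = 0 := by linarith
    rcases mul_eq_zero.1 this with h | h <;> linarith
  rw [hb] at h0 hr
  exact hr (by linarith)

theorem unfuseEvent_mem_criticalValues {p : Fin m × ℝ} (hp : p ∈ unfuseEvents f) :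
    p.2 ∈ criticalValues f := by
  obtain ⟨hpos, hl, hr⟩ := hp
  refine ⟨hpos, ?_⟩
  rintro ⟨a, b, hab⟩
  have h1 := (hl.filter_mono (nhdsWithin_mono _ Set.Iio_subset_Iic_self)).and
    (hab.filter_mono nhdsWithin_le_nhds)
  obtain ⟨s, ⟨hs, hsa⟩, hps⟩ := (h1.and self_mem_nhdsWithin).exists
  have hps : s < p.2 := hps
  have h0 := hl.self_of_nhdsWithin Set.self_mem_Iic
  obtain ⟨r, hr, hra⟩ := (hr.and (hab.filter_mono nhdsWithin_le_nhds)).exists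
  rw [hsa] at hs
  rw [hab.self_of_nhds] at h0
  rw [hra] at hr
  simp only [Pi.add_apply, Pi.smul_apply, smul_eq_mul] at hs h0 hr
  have hb : b p.1.succ = b p.1.castSucc := by
    have : (s - p.2) * (b p.1.succ - b p.1.castSucc) = 0 := by linarith
    rcases mul_eq_zero.1 this with h | h <;> linarith
  rw [hb] at h0 hr
  exact hr (by linarith)

theorem finite_fuseEvents {α : Fin m → ℝ} (hα : ∀ t, 0 ≤ α t) (y : Fin (m + 1) → ℝ) :
    (fuseEvents (solutionPath α y)).Finite :=
  (Set.finite_univ.prod (finite_criticalValues hα y)).subset fun _ hp =>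
    ⟨Set.mem_univ _, fuseEvent_mem_criticalValues hp⟩

theorem finite_unfuseEvents {α : Fin m → ℝ} (hα : ∀ t, 0 ≤ α t) (y : Fin (m + 1) → ℝ) :
    (unfuseEvents (solutionPath α y)).Finite :=
  (Set.finite_univ.prod (finite_criticalValues hα y)).subset fun _ hp =>
    ⟨Set.mem_univ _, unfuseEvent_mem_criticalValues hp⟩

end Events

/-! ### The taut string certificate of optimality. -/

section TautString

/-- Optimality certificate: a string `X` with the endpoints of `Y` that stays in the tube of radius
`γ α` around `Y` and bends upwards (downwards) only at the upper (lower) end of the tube. -/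
theorem isSolution_of_string {m : ℕ} {α : Fin m → ℝ} {γ : ℝ} (X Y : ℕ → ℝ)
    (h1 : X 1 = Y 1) (hlast : X (m + 2) = Y (m + 2))
    (htube : ∀ t : Fin m, |X (t + 2) - Y (t + 2)| ≤ γ * α t)
    (hbend : ∀ t : Fin m, (X (t + 2) - Y (t + 2)) * (X (t + 3) - 2 * X (t + 2) + X (t + 1))
      = γ * α t * |X (t + 3) - 2 * X (t + 2) + X (t + 1)|) :
    IsSolution α (fun t => Y (t + 2) - Y (t + 1)) γ (fun t => X (t + 2) - X (t + 1)) := by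
  intro z
  set y : Fin (m + 1) → ℝ := fun t => Y (t + 2) - Y (t + 1) with hy
  set x : Fin (m + 1) → ℝ := fun t => X (t + 2) - X (t + 1) with hx
  set R : ℕ → ℝ := fun j => X j - Y j with hR
  -- Summation by parts; there are no boundary terms because string and center agree at both ends.
  have hparts : ∀ v : Fin (m + 1) → ℝ,
      ∑ t, (x t - y t) * v t = - ∑ t : Fin m, R (t + 2) * jump v t := by
    intro v
    have e1 : ∑ t : Fin (m + 1), R (t + 2) * v t = ∑ t : Fin m, R (t + 2) * v t.castSucc := by
      rw [Fin.sum_univ_castSucc]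
      simp [hR, hlast]
    have e2 : ∑ t : Fin (m + 1), R (t + 1) * v t = ∑ t : Fin m, R (t + 2) * v t.succ := by
      rw [Fin.sum_univ_succ]
      simp [hR, h1, add_assoc]
    have e3 : ∑ t, (x t - y t) * v t
        = ∑ t : Fin (m + 1), R (t + 2) * v t - ∑ t : Fin (m + 1), R (t + 1) * v t := by
      rw [← Finset.sum_sub_distrib]
      exact Finset.sum_congr rfl fun t _ => by simp only [hx, hy, hR]; ring
    rw [e3, e1, e2, ← Finset.sum_sub_distrib, ← Finset.sum_neg_distrib]
    exact Finset.sum_congr rfl fun t _ => by unfold jump; ring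
  have h2 : ∑ t, (z t - y t) ^ 2 = ∑ t, (x t - y t) ^ 2
      + 2 * ∑ t, (x t - y t) * (z t - x t) + ∑ t, (z t - x t) ^ 2 := by
    rw [Finset.mul_sum, ← Finset.sum_add_distrib, ← Finset.sum_add_distrib]
    exact Finset.sum_congr rfl fun t _ => by ring
  have h3 : 0 ≤ ∑ t, (z t - x t) ^ 2 := Finset.sum_nonneg fun t _ => sq_nonneg _
  have h4 : γ * ∑ t, α t * |jump x t| - γ * ∑ t, α t * |jump z t|
      ≤ - ∑ t : Fin m, R (t + 2) * jump (fun t => z t - x t) t := by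
    rw [Finset.mul_sum, Finset.mul_sum, ← Finset.sum_sub_distrib, ← Finset.sum_neg_distrib]
    refine Finset.sum_le_sum fun t _ => ?_
    have e1 : jump x t = X (t + 3) - 2 * X (t + 2) + X (t + 1) := by
      simp only [jump, hx, Fin.val_succ, Fin.val_castSucc]
      rw [show (t : ℕ) + 1 + 2 = t + 3 by ring, show (t : ℕ) + 1 + 1 = t + 2 by ring]
      ring
    have e2 := hbend t
    rw [← e1] at e2
    have e3 : jump (fun t => z t - x t) t = jump z t - jump x t := by unfold jump; ring
    have e4 : R (t + 2) * jump z t ≤ γ * α t * |jump z t| := by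
      calc R (t + 2) * jump z t ≤ |R (t + 2) * jump z t| := le_abs_self _
        _ = |R (t + 2)| * |jump z t| := abs_mul _ _
        _ ≤ _ := by gcongr; exact htube t
    have e5 : R (t + 2) * jump x t = γ * α t * |jump x t| := e2
    rw [e3]
    linarith
  have h5 := hparts (fun t => z t - x t)
  unfold objective
  rw [h2, h5]
  unfold jump at h4 ⊢
  linarith

end TautString

end WeightedFusedLasso

namespace WeightedFusedLasso

/-! ### The explicit taut string with one pivot and one last contact. -/

noncomputable section Phase

/-- The negated tail sums of the input: `(-1)^j q_j` for `j ≤ m + 1` and `0` beyond. -/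
def height (m j : ℕ) : ℝ := if j ≤ m + 1 then (-1) ^ j * q j else 0

/-- The quadratically growing weights. -/
def quadWeights (m : ℕ) : Fin m → ℝ := fun t => ((t : ℝ) + 1) ^ 2

/-- The input whose negated tail sums are `height m`. -/
def zigzagInput (m : ℕ) : Fin (m + 1) → ℝ := fun t => height m (t + 2) - height m (t + 1)

theorem quadWeights_nonneg (m : ℕ) (t : Fin m) : 0 ≤ quadWeights m t := sq_nonneg _

/-- The center of the tube at `j`, with the sign chosen so that it is `q K` at `K`. -/
def center (K j : ℕ) : ℝ := (-1) ^ (K + j) * q j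

/-- The upper end of the tube at `j`. -/
def upper (K : ℕ) (γ : ℝ) (j : ℕ) : ℝ := center K j + γ * ((j : ℝ) - 1) ^ 2

/-- The lower end of the tube at `K`. -/
def pivot (K : ℕ) (γ : ℝ) : ℝ := q K - γ * ((K : ℝ) - 1) ^ 2

/-- The slope of the segment from the upper end at `p` to the pivot at `K`. -/
def slope (K p : ℕ) (γ : ℝ) : ℝ := (pivot K γ - upper K γ p) / ((K : ℝ) - p)

/-- The string that follows the upper end of the tube up to `p`, is straight from `p` to `K`, and
zigzags between the inner ends of the tube from there on. -/
def phaseString (m K p : ℕ) (γ : ℝ) (j : ℕ) : ℝ :=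
  if j ≤ p then upper K γ j
  else if j ≤ K then upper K γ p + slope K p γ * ((j : ℝ) - p)
  else if j ≤ m + 1 then (-1) ^ (K + j) * (q j - γ * ((j : ℝ) - 1) ^ 2)
  else 0

theorem phaseString_of_le {m K p : ℕ} {γ : ℝ} {j : ℕ} (h : j ≤ p) :
    phaseString m K p γ j = upper K γ j := by
  simp [phaseString, h]

theorem phaseString_of_mem_line {m K p : ℕ} {γ : ℝ} {j : ℕ} (h : p ≤ j) (h' : j ≤ K) :
    phaseString m K p γ j = upper K γ p + slope K p γ * ((j : ℝ) - p) := by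
  unfold phaseString
  split_ifs with h1
  · obtain rfl : j = p := le_antisymm h1 h
    simp
  · rfl

theorem phaseString_pivot {m K p : ℕ} {γ : ℝ} (h : p < K) :
    phaseString m K p γ K = pivot K γ := by
  rw [phaseString_of_mem_line h.le le_rfl, slope, div_mul_cancel₀]
  · ring
  · have : (p : ℝ) < K := by exact_mod_cast h
    exact sub_ne_zero.2 this.ne'

theorem neg_one_pow_add_self (K : ℕ) : (-1 : ℝ) ^ (K + K) = 1 := Even.neg_one_pow ⟨K, rfl⟩

theorem center_self (K : ℕ) : center K K = q K := by
  rw [center, neg_one_pow_add_self, one_mul]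

theorem phaseString_of_ge {m K p : ℕ} {γ : ℝ} (hpK : p < K) {j : ℕ} (h : K ≤ j) (h' : j ≤ m + 1) :
    phaseString m K p γ j = (-1) ^ (K + j) * (q j - γ * ((j : ℝ) - 1) ^ 2) := by
  rcases h.eq_or_lt with rfl | h
  · rw [phaseString_pivot hpK, neg_one_pow_add_self, one_mul, pivot]
  · simp [phaseString, h', not_le.2 h, not_le.2 (hpK.trans h)]

theorem phaseString_of_gt {m K p : ℕ} {γ : ℝ} (hpK : p < K) (hK : K ≤ m + 1) :
    phaseString m K p γ (m + 2) = 0 := by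
  simp [phaseString, show ¬ m + 2 ≤ p by omega, show ¬ m + 2 ≤ K by omega]

/-- The inequalities under which `phaseString` is the taut string. -/
structure IsPhase (m K p : ℕ) (γ : ℝ) : Prop where
  two_le : 2 ≤ p
  lt_pivot : p < K
  pivot_le : K ≤ m + 1
  nonneg : 0 ≤ γ
  upper_convex : ∀ j, 1 ≤ j → j + 1 < p →
    0 ≤ upper K γ (j + 2) - 2 * upper K γ (j + 1) + upper K γ j
  upper_le_slope : ∀ j, j + 1 = p → upper K γ p - upper K γ j ≤ slope K p γ
  slope_nonneg : 0 ≤ slope K p γ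
  line_mem : ∀ j : ℕ, p < j → j < K →
    |upper K γ p + slope K p γ * ((j : ℝ) - p) - center K j| ≤ γ * ((j : ℝ) - 1) ^ 2
  zigzag : ∀ j : ℕ, K ≤ j → j ≤ m + 1 → 0 ≤ q j - γ * ((j : ℝ) - 1) ^ 2

/-- The second difference of a sequence at `j + 1`. -/
def bend (V : ℕ → ℝ) (j : ℕ) : ℝ := V (j + 2) - 2 * V (j + 1) + V j

/-- The first alternative holds up to the last contact `p`, the third on the straight piece, the
second at the pivot; beyond the pivot the first two alternate with parity. -/
theorem phaseString_tube {m K p : ℕ} {γ : ℝ} (h : IsPhase m K p γ) {j : ℕ} (hj : 1 ≤ j)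
    (hjm : j ≤ m) :
    (phaseString m K p γ (j + 1) - center K (j + 1) = γ * (j : ℝ) ^ 2 ∧
        0 ≤ bend (phaseString m K p γ) j) ∨
      (phaseString m K p γ (j + 1) - center K (j + 1) = -(γ * (j : ℝ) ^ 2) ∧
        bend (phaseString m K p γ) j ≤ 0) ∨
      (|phaseString m K p γ (j + 1) - center K (j + 1)| ≤ γ * (j : ℝ) ^ 2 ∧
        bend (phaseString m K p γ) j = 0) := by
  have hpK := h.lt_pivot
  have hKm := h.pivot_le
  unfold bend
  rcases lt_trichotomy (j + 1) p with h1 | h1 | h1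
  · left
    rw [phaseString_of_le (show j + 2 ≤ p from h1), phaseString_of_le h1.le,
      phaseString_of_le (by omega)]
    refine ⟨?_, h.upper_convex j hj h1⟩
    simp [upper]
  · left
    rw [phaseString_of_mem_line (show p ≤ j + 2 by omega) (by omega), phaseString_of_le h1.le,
      phaseString_of_le (by omega)]
    have h2 := h.upper_le_slope j h1
    constructor
    · simp [upper]
    · subst h1
      push_cast
      linarith
  rcases lt_trichotomy (j + 1) K with h2 | h2 | h2
  · right; right
    rw [phaseString_of_mem_line (show p ≤ j + 2 by omega) (by omega),
      phaseString_of_mem_line h1.le h2.le, phaseString_of_mem_line (show p ≤ j by omega) (by omega)]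
    constructor
    · have h3 := h.line_mem (j + 1) h1 h2
      push_cast at h3 ⊢
      simpa using h3
    · push_cast; ring
  · right; left
    have e0 : phaseString m K p γ (j + 1) = pivot K γ := by rw [h2, phaseString_pivot hpK]
    have e1 : phaseString m K p γ j = pivot K γ - slope K p γ := by
      rw [← phaseString_pivot (m := m) hpK, phaseString_of_mem_line (by omega) (by omega),
        phaseString_of_mem_line hpK.le le_rfl, ← h2]
      push_cast; ring
    have h4 := h.zigzag K le_rfl hKm
    -- The next point is an inner end of a tube on the other side of 0, or the right end of the
    -- string.
    have e2 : phaseString m K p γ (j + 2) ≤ 0 := by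
      rcases (show j + 2 ≤ m + 1 ∨ j = m by omega) with h3 | h3
      · rw [phaseString_of_ge hpK (by omega) h3, show K + (j + 2) = (K + K) + 1 by omega, pow_succ,
          neg_one_pow_add_self]
        have := h.zigzag (j + 2) (by omega) h3
        linarith
      · rw [h3, phaseString_of_gt hpK hKm]
    constructor
    · rw [e0, h2, center_self, pivot, ← h2]; push_cast; ring
    · rw [e0, e1]
      have := h.slope_nonneg
      have h5 : 0 ≤ pivot K γ := h4
      linarith
  · have e1 := phaseString_of_ge (γ := γ) hpK (show K ≤ j + 1 by omega) (show j + 1 ≤ m + 1 by omega)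
    have e0 := phaseString_of_ge (γ := γ) hpK (show K ≤ j by omega) (show j ≤ m + 1 by omega)
    have z1 := h.zigzag (j + 1) (by omega) (by omega)
    have z0 := h.zigzag j (by omega) (by omega)
    obtain ⟨c, hc, e2⟩ : ∃ c, 0 ≤ c ∧ phaseString m K p γ (j + 2) = (-1) ^ (K + j) * c := by
      rcases (show j + 2 ≤ m + 1 ∨ j = m by omega) with h3 | h3
      · refine ⟨_, h.zigzag (j + 2) (by omega) h3, ?_⟩
        rw [phaseString_of_ge hpK (by omega) h3, ← add_assoc, pow_add]
        norm_num
      · exact ⟨0, le_rfl, by rw [h3, phaseString_of_gt hpK hKm, mul_zero]⟩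
    rw [e2, e1, e0, center, ← add_assoc, pow_succ]
    push_cast at z1 ⊢
    rcases neg_one_pow_eq_or ℝ (K + j) with hz | hz
    · left
      rw [hz]
      constructor
      · ring
      · linarith
    · right; left
      rw [hz]
      constructor
      · ring
      · linarith

/-- The factor `(-1) ^ K` undoes the reflection that made the center positive at the pivot. -/
theorem isSolution_phaseString {m K p : ℕ} {γ : ℝ} (h : IsPhase m K p γ) :
    IsSolution (quadWeights m) (zigzagInput m) γ (fun t : Fin (m + 1) =>
      (-1) ^ K * phaseString m K p γ (t + 2) - (-1) ^ K * phaseString m K p γ (t + 1)) := by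
  have hpK := h.lt_pivot
  have hKm := h.pivot_le
  have hp := h.two_le
  have hsign : (-1 : ℝ) ^ K * (-1) ^ K = 1 := by rw [← pow_add, neg_one_pow_add_self]
  have habs : |(-1 : ℝ) ^ K| = 1 := by rw [abs_pow, abs_neg, abs_one, one_pow]
  have hheight : ∀ j, j ≤ m + 1 → height m j = (-1) ^ K * center K j := by
    intro j hj
    rw [height, if_pos hj, center, pow_add]
    linear_combination (-1 : ℝ) * (-1) ^ j * q j * hsign
  have hdiff : ∀ t : Fin m, (-1) ^ K * phaseString m K p γ (t + 2) - height m (t + 2)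
      = (-1) ^ K * (phaseString m K p γ (t + 2) - center K (t + 2)) := by
    intro t
    rw [hheight _ (by omega)]; ring
  have hbend : ∀ t : Fin m, (-1) ^ K * phaseString m K p γ (t + 3)
      - 2 * ((-1) ^ K * phaseString m K p γ (t + 2)) + (-1) ^ K * phaseString m K p γ (t + 1)
      = (-1) ^ K * bend (phaseString m K p γ) (t + 1) := by
    intro t
    rw [bend]; ring
  refine isSolution_of_string (fun j => (-1) ^ K * phaseString m K p γ j) (height m) ?_ ?_ ?_ ?_
  · rw [hheight _ (by omega), phaseString_of_le (by omega)]
    simp [upper]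
  · rw [phaseString_of_gt hpK hKm]
    simp [height]
  · intro t
    rw [hdiff, abs_mul, habs, one_mul]
    have hpos : 0 ≤ γ * (((t : ℕ) + 1 : ℕ) : ℝ) ^ 2 := mul_nonneg h.nonneg (sq_nonneg _)
    have hq : quadWeights m t = (((t : ℕ) + 1 : ℕ) : ℝ) ^ 2 := by simp [quadWeights]
    rw [hq]
    rcases phaseString_tube h (j := t + 1) (by omega) (by omega) with ⟨h1, -⟩ | ⟨h1, -⟩ | ⟨h1, -⟩
    · rw [h1, abs_of_nonneg hpos]
    · rw [h1, abs_neg, abs_of_nonneg hpos]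
    · exact h1
  · intro t
    have hq : quadWeights m t = (((t : ℕ) + 1 : ℕ) : ℝ) ^ 2 := by simp [quadWeights]
    rw [hdiff, hbend, abs_mul, habs, one_mul, hq]
    have hmul : ∀ a b : ℝ, (-1) ^ K * a * ((-1) ^ K * b) = a * b := by
      intro a b; linear_combination a * b * hsign
    rw [hmul]
    rcases phaseString_tube h (j := t + 1) (by omega) (by omega) with
      ⟨h1, h2⟩ | ⟨h1, h2⟩ | ⟨h1, h2⟩
    · rw [h1, abs_of_nonneg h2]
    · rw [h1, abs_of_nonpos h2]; ring
    · rw [h2]; simp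

theorem jump_solutionPath_of_isPhase {m K p : ℕ} {γ : ℝ} (h : IsPhase m K p γ) (t : Fin m) :
    jump (solutionPath (quadWeights m) (zigzagInput m) γ) t
      = (-1) ^ K * bend (phaseString m K p γ) (t + 1) := by
  rw [← (isSolution_iff_eq_solutionPath _ (quadWeights_nonneg m) _ h.nonneg _).1
    (isSolution_phaseString h)]
  simp only [jump, bend, Fin.val_succ, Fin.val_castSucc]
  rw [show (t : ℕ) + 1 + 2 = t + 3 by ring, show (t : ℕ) + 1 + 1 = t + 2 by ring]
  ring

/-- The jump at the last contact with the upper end of the tube. -/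
theorem jump_ne_zero_of_isPhase {m K i : ℕ} {γ : ℝ} (h : IsPhase m K (i + 1) γ)
    (hs : upper K γ (i + 1) - upper K γ i < slope K (i + 1) γ) (t : Fin m)
    (ht : (t : ℕ) + 1 = i) :
    jump (solutionPath (quadWeights m) (zigzagInput m) γ) t ≠ 0 := by
  rw [jump_solutionPath_of_isPhase h, ht, bend,
    phaseString_of_mem_line (show i + 1 ≤ i + 2 by omega) h.lt_pivot, phaseString_of_le le_rfl,
    phaseString_of_le (by omega)]
  refine mul_ne_zero (pow_ne_zero _ (by norm_num)) (ne_of_gt ?_)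
  push_cast
  linarith

/-- The jump just after the last contact with the upper end of the tube. -/
theorem jump_eq_zero_of_isPhase {m K p : ℕ} {γ : ℝ} (h : IsPhase m K p γ) (hpK : p + 2 ≤ K)
    (t : Fin m) (ht : (t : ℕ) + 1 = p) :
    jump (solutionPath (quadWeights m) (zigzagInput m) γ) t = 0 := by
  rw [jump_solutionPath_of_isPhase h, ht, bend,
    phaseString_of_mem_line (show p ≤ p + 2 by omega) hpK,
    phaseString_of_mem_line (show p ≤ p + 1 by omega) (by omega),
    phaseString_of_mem_line le_rfl (by omega)]
  push_cast
  ring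

end Phase

end WeightedFusedLasso

namespace WeightedFusedLasso

/-! ### Growth estimates and the parameters at which the last contact moves. -/

noncomputable section Thresholds

theorem g_add_three (j : ℕ) : g (j + 3) = 4 / 3 * 2 ^ j - 1 := by
  induction j with
  | zero => norm_num [g]
  | succ j ih => rw [show j + 1 + 3 = j + 4 by ring, g, ih, pow_succ]; ring

/-- The prescribed second difference of `q` is (8/3) 2^j - 1: the exponential accounts for the first
term and the quadratic for the second. -/
theorem q_succ (j : ℕ) :
    q (j + 1) = 4 / 3 * 2 ^ (j + 1) - 1 - ((j : ℝ) + 1) / 6 - ((j : ℝ) + 1) ^ 2 / 2 := by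
  induction j using Nat.strong_induction_on with
  | _ j ih =>
    match j with
    | 0 => norm_num [q]
    | 1 => norm_num [q]
    | j + 2 =>
      rw [show j + 2 + 1 = j + 3 by ring, q, g_add_three, ih (j + 1) (by omega), ih j (by omega)]
      push_cast
      ring

theorem q_le (j : ℕ) : q j ≤ 4 / 3 * 2 ^ j := by
  rcases j with _ | j
  · norm_num [q]
  · rw [q_succ]
    have : (0 : ℝ) ≤ j := j.cast_nonneg
    nlinarith

theorem le_q {j : ℕ} (hj : 1 ≤ j) : 4 / 3 * 2 ^ j - 2 * (j : ℝ) ^ 2 ≤ q j := by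
  obtain ⟨j, rfl⟩ := Nat.exists_eq_add_of_le' hj
  rw [q_succ]
  push_cast
  have : (0 : ℝ) ≤ j := j.cast_nonneg
  nlinarith

theorem q_nonneg (j : ℕ) : 0 ≤ q j := by
  rcases j with _ | j
  · norm_num [q]
  · rw [q_succ]
    have h : 3 * ((j : ℝ) + 1) ^ 2 + (j + 1) + 6 ≤ 8 * 2 ^ (j + 1) := by
      induction j with
      | zero => norm_num
      | succ j ih =>
        rw [pow_succ (2 : ℝ)]
        push_cast
        have : (0 : ℝ) ≤ j := j.cast_nonneg
        nlinarith
    linarith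

theorem abs_center (K j : ℕ) : |center K j| = q j := by
  rw [center, abs_mul, abs_pow, abs_neg, abs_one, one_pow, one_mul, abs_of_nonneg (q_nonneg j)]

/-- `2^K` dominates `K^3 2^j` for all `j ≤ 7 K / 8`. -/
structure IsLarge (K : ℕ) : Prop where
  le : 300 ≤ K
  dominates : ∀ j : ℕ, 8 * j ≤ 7 * K → 1000 * (K : ℝ) ^ 3 * 2 ^ j ≤ 2 ^ K

/-- Here `l + 37` stands for `K / 8`, at least 37 once `K ≥ 300`. The induction works because
(5/4)^3 < 2. -/
theorem cube_le_two_pow (l : ℕ) :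
    1000 * (8 * ((l + 37 : ℕ) : ℝ) + 8) ^ 3 ≤ 2 ^ (l + 37) := by
  induction l with
  | zero => norm_num
  | succ l ih =>
    rw [show l + 1 + 37 = l + 37 + 1 by ring, pow_succ]
    refine le_trans ?_ (mul_le_mul_of_nonneg_right ih zero_le_two)
    push_cast
    have hl : (0 : ℝ) ≤ l := l.cast_nonneg
    have h1 : (8 * ((l : ℝ) + 37 + 1) + 8) ≤ (8 * ((l : ℝ) + 37) + 8) * (5 / 4) := by linarith
    have h2 : (8 * ((l : ℝ) + 37 + 1) + 8) ^ 3 ≤ ((8 * ((l : ℝ) + 37) + 8) * (5 / 4)) ^ 3 := by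
      gcongr
    have h3 : 0 ≤ (8 * ((l : ℝ) + 37) + 8) ^ 3 := by positivity
    rw [mul_pow] at h2
    linarith

theorem isLarge_of_le {K : ℕ} (hK : 300 ≤ K) : IsLarge K := by
  refine ⟨hK, fun j hj => ?_⟩
  obtain ⟨l, hl⟩ := Nat.exists_eq_add_of_le' (show 37 ≤ K / 8 by omega)
  have h1 := cube_le_two_pow l
  rw [← hl] at h1
  have h2 : (K : ℝ) ≤ 8 * ((K / 8 : ℕ) : ℝ) + 8 := by
    exact_mod_cast (show K ≤ 8 * (K / 8) + 8 by omega)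
  calc 1000 * (K : ℝ) ^ 3 * 2 ^ j ≤ 1000 * (8 * ((K / 8 : ℕ) : ℝ) + 8) ^ 3 * 2 ^ j := by gcongr
    _ ≤ 2 ^ (K / 8) * 2 ^ j := by gcongr
    _ = 2 ^ (K / 8 + j) := by rw [pow_add]
    _ ≤ 2 ^ K := pow_le_pow_right₀ one_le_two (by omega)

theorem IsLarge.cast_le {K : ℕ} (h : IsLarge K) : (300 : ℝ) ≤ K := by exact_mod_cast h.le

theorem IsLarge.sq_le {K : ℕ} (h : IsLarge K) : 1000 * (K : ℝ) ^ 2 ≤ 2 ^ K := by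
  have h1 := h.dominates 0 (by omega)
  have h2 := h.cast_le
  have h3 : (K : ℝ) ^ 2 * 1 ≤ (K : ℝ) ^ 2 * K := by gcongr; linarith
  rw [pow_zero] at h1
  nlinarith

theorem IsLarge.mul_q_le {K j : ℕ} (h : IsLarge K) (hj : 8 * j ≤ 7 * K) :
    500 * (K * q j) ≤ 2 ^ K := by
  have h1 := h.dominates j hj
  have h2 := h.cast_le
  have h3 := q_le j
  have h4 : (0 : ℝ) < 2 ^ j := by positivity
  have h5 : (K : ℝ) * q j ≤ K * (4 / 3 * 2 ^ j) := by gcongr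
  have h6 : (1 : ℝ) ≤ (K : ℝ) ^ 2 := by nlinarith
  have h7 : (K : ℝ) * 2 ^ j * 1 ≤ K * 2 ^ j * K ^ 2 := by gcongr
  nlinarith

/-- The cube in `IsLarge` is spent here: two powers of `K` pay for the denominator in γ ≈ 2^K / K^2,
the third for a length of up to `K`. -/
theorem IsLarge.mul_q_le_param {K j : ℕ} (h : IsLarge K) (hj : 8 * j ≤ 7 * K) {γ : ℝ}
    (hγ : 6 / 5 * 2 ^ K ≤ γ * (K : ℝ) ^ 2) : 800 * (K * q j) ≤ γ := by
  have h1 := h.dominates j hj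
  have h2 := h.cast_le
  have h3 := q_le j
  have h5 : (K : ℝ) * q j ≤ K * (4 / 3 * 2 ^ j) := by gcongr
  have h6 : 0 < (K : ℝ) ^ 2 := by positivity
  have h7 : (1200 * (K * 2 ^ j)) * (K : ℝ) ^ 2 ≤ γ * (K : ℝ) ^ 2 := by nlinarith
  have h8 := le_of_mul_le_mul_right h7 h6
  have h9 : (0 : ℝ) ≤ K * 2 ^ j := by positivity
  linarith

/-- The quotient 2^j / j^2 is nondecreasing from 3 on. -/
theorem two_pow_mul_sq_le {K : ℕ} (hK : 3 ≤ K) (l : ℕ) :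
    2 ^ K * ((K + l : ℕ) : ℝ) ^ 2 ≤ 2 ^ (K + l) * (K : ℝ) ^ 2 := by
  induction l with
  | zero => simp
  | succ l ih =>
    have h1 : (3 : ℝ) ≤ ((K + l : ℕ) : ℝ) := by exact_mod_cast (show 3 ≤ K + l by omega)
    have h2 : ((K + (l + 1) : ℕ) : ℝ) = ((K + l : ℕ) : ℝ) + 1 := by push_cast; ring
    rw [h2, ← add_assoc, pow_succ (2 : ℝ)]
    have h3 : (((K + l : ℕ) : ℝ) + 1) ^ 2 ≤ 2 * ((K + l : ℕ) : ℝ) ^ 2 := by nlinarith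
    have h4 : (2 : ℝ) ^ K * (((K + l : ℕ) : ℝ) + 1) ^ 2
        ≤ 2 ^ K * (2 * ((K + l : ℕ) : ℝ) ^ 2) := by gcongr
    linarith

/-- How far the pivot lies above the line through the upper ends of the tube at `i` and `i + 1`. -/
def gap (K i : ℕ) (γ : ℝ) : ℝ :=
  pivot K γ - upper K γ i - ((K : ℝ) - i) * (upper K γ (i + 1) - upper K γ i)

def gapNum (K i : ℕ) : ℝ :=
  q K - center K i - ((K : ℝ) - i) * (center K (i + 1) - center K i)

def gapDen (K i : ℕ) : ℝ :=
  ((K : ℝ) - 1) ^ 2 + ((i : ℝ) - 1) ^ 2 + ((K : ℝ) - i) * (2 * i - 1)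

/-- The parameter at which the pivot lies on the line through the upper ends of the tube at `i` and
`i + 1`. -/
def threshold (K i : ℕ) : ℝ := gapNum K i / gapDen K i

theorem gap_eq (K i : ℕ) (γ : ℝ) : gap K i γ = gapNum K i - γ * gapDen K i := by
  simp only [gap, gapNum, gapDen, pivot, upper]
  push_cast
  ring

theorem gapDen_bounds {K i : ℕ} (h : 300 ≤ K) (hi : 1 ≤ i) (hiK : 32 * i ≤ K) :
    961 / 1000 * (K : ℝ) ^ 2 ≤ gapDen K i ∧ gapDen K i ≤ 107 / 100 * (K : ℝ) ^ 2 := by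
  have h1 : (300 : ℝ) ≤ K := by exact_mod_cast h
  have h2 : (1 : ℝ) ≤ i := by exact_mod_cast hi
  have h3 : 32 * (i : ℝ) ≤ K := by exact_mod_cast hiK
  unfold gapDen
  constructor
  · have h4 : 0 ≤ ((K : ℝ) - i) * (2 * i - 1) := mul_nonneg (by linarith) (by linarith)
    nlinarith [sq_nonneg ((i : ℝ) - 1)]
  · have h4 : ((K : ℝ) - i) * (2 * i - 1) ≤ K * (K / 16) := by
      apply mul_le_mul <;> linarith
    have h5 : ((i : ℝ) - 1) ^ 2 ≤ (K / 32) ^ 2 := by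
      apply pow_le_pow_left₀ <;> linarith
    nlinarith

theorem gapDen_pos {K i : ℕ} (h : 300 ≤ K) (hi : 1 ≤ i) (hiK : 32 * i ≤ K) : 0 < gapDen K i := by
  have h1 : (300 : ℝ) ≤ K := by exact_mod_cast h
  have := (gapDen_bounds h hi hiK).1
  nlinarith

theorem gapNum_bounds {K i : ℕ} (h : IsLarge K) (hiK : 32 * (i + 1) ≤ K) :
    131 / 100 * 2 ^ K ≤ gapNum K i ∧ gapNum K i ≤ 1345 / 1000 * 2 ^ K := by
  have hK := h.cast_le
  have h1 := h.mul_q_le (j := i) (by omega)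
  have h2 := h.mul_q_le (j := i + 1) (by omega)
  have hsq := h.sq_le
  have h3 : (i : ℝ) ≤ K := by exact_mod_cast (show i ≤ K by omega)
  have hi0 : (0 : ℝ) ≤ i := i.cast_nonneg
  have h4 : |((K : ℝ) - i) * (center K (i + 1) - center K i)| ≤ K * (q (i + 1) + q i) := by
    rw [abs_mul, abs_of_nonneg (by linarith : (0 : ℝ) ≤ K - i)]
    apply mul_le_mul
    · linarith
    · exact (abs_sub _ _).trans (by rw [abs_center, abs_center])
    · exact abs_nonneg _
    · linarith
  have h5 : |center K i| ≤ K * q i := by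
    rw [abs_center]
    have := q_nonneg i
    nlinarith
  have h6 := q_le K
  have h7 := le_q (j := K) (by omega)
  have h8 := abs_le.1 h4
  have h9 := abs_le.1 h5
  unfold gapNum
  constructor
  · linarith [h8.2, h9.2]
  · linarith [h8.1, h9.1]

/-- The constants of the two preceding bounds fit because 1.31 / 1.07 > 6/5 and 1.345 / 0.961 < 7/5.
-/
theorem threshold_bounds {K i : ℕ} (h : IsLarge K) (hi : 1 ≤ i) (hiK : 32 * (i + 1) ≤ K) :
    6 / 5 * 2 ^ K ≤ threshold K i * (K : ℝ) ^ 2 ∧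
      threshold K i * (K : ℝ) ^ 2 ≤ 7 / 5 * 2 ^ K := by
  have hD := gapDen_bounds h.le hi (by omega)
  have hDpos := gapDen_pos h.le hi (show 32 * i ≤ K by omega)
  have hN := gapNum_bounds h hiK
  have hK := h.cast_le
  have hK2 : 0 < (K : ℝ) ^ 2 := by positivity
  have h2K : (0 : ℝ) < 2 ^ K := by positivity
  have hprod : 0 < (2 : ℝ) ^ K * (K : ℝ) ^ 2 := by positivity
  have e : threshold K i * (K : ℝ) ^ 2 = gapNum K i * (K : ℝ) ^ 2 / gapDen K i :=
    div_mul_eq_mul_div _ _ _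
  rw [e]
  constructor
  · rw [le_div_iff₀ hDpos]
    have e1 := mul_le_mul_of_nonneg_left hD.2 h2K.le
    have e2 := mul_le_mul_of_nonneg_right hN.1 hK2.le
    linarith
  · rw [div_le_iff₀ hDpos]
    have e1 := mul_le_mul_of_nonneg_left hD.1 h2K.le
    have e2 := mul_le_mul_of_nonneg_right hN.2 hK2.le
    linarith

theorem le_threshold_iff {K i : ℕ} (h : 300 ≤ K) (hi : 1 ≤ i) (hiK : 32 * i ≤ K) {γ : ℝ} :
    γ ≤ threshold K i ↔ 0 ≤ gap K i γ := by
  rw [threshold, le_div_iff₀ (gapDen_pos h hi hiK), gap_eq, sub_nonneg]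

theorem threshold_le_iff {K i : ℕ} (h : 300 ≤ K) (hi : 1 ≤ i) (hiK : 32 * i ≤ K) {γ : ℝ} :
    threshold K i ≤ γ ↔ gap K i γ ≤ 0 := by
  rw [threshold, div_le_iff₀ (gapDen_pos h hi hiK), gap_eq, sub_nonpos]

theorem lt_threshold_iff {K i : ℕ} (h : 300 ≤ K) (hi : 1 ≤ i) (hiK : 32 * i ≤ K) {γ : ℝ} :
    γ < threshold K i ↔ 0 < gap K i γ := by
  rw [threshold, lt_div_iff₀ (gapDen_pos h hi hiK), gap_eq, sub_pos]

/-- The parabola contributes 2γ to the second difference, the centers at most 4γ/800 in absolute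
value. -/
theorem upper_bend_pos {K j : ℕ} (h : IsLarge K) (hj : 8 * (j + 2) ≤ 7 * K) {γ : ℝ}
    (hγ : 6 / 5 * 2 ^ K ≤ γ * (K : ℝ) ^ 2) :
    0 < upper K γ (j + 2) - 2 * upper K γ (j + 1) + upper K γ j := by
  have hK := h.cast_le
  have hq : ∀ l, 8 * l ≤ 7 * K → |center K l| ≤ γ / 800 := by
    intro l hl
    have h1 := h.mul_q_le_param hl hγ
    have h2 := q_nonneg l
    rw [abs_center]
    nlinarith
  have hpos : 0 < γ := by
    have h2K : (0 : ℝ) < 2 ^ K := by positivity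
    by_contra hcon
    have := mul_nonpos_of_nonpos_of_nonneg (not_lt.1 hcon) (sq_nonneg (K : ℝ))
    linarith
  have h0 := abs_le.1 (hq j (by omega))
  have h1 := abs_le.1 (hq (j + 1) (by omega))
  have h2 := abs_le.1 (hq (j + 2) (by omega))
  have e : upper K γ (j + 2) - 2 * upper K γ (j + 1) + upper K γ j
      = center K (j + 2) - 2 * center K (j + 1) + center K j + 2 * γ := by
    simp only [upper]; push_cast; ring
  rw [e]
  linarith [h0.1, h1.2, h2.1]

theorem gap_sub_gap (K i : ℕ) (γ : ℝ) : gap K i γ - gap K (i + 1) γ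
    = ((K : ℝ) - (i + 1)) * (upper K γ (i + 2) - 2 * upper K γ (i + 1) + upper K γ i) := by
  simp only [gap]
  push_cast
  rw [show i + 1 + 1 = i + 2 by ring]
  ring

/-- Convexity of the upper end makes `gap` decrease in the index, so at the parameter where the gap
at `i + 1` closes the one at `i` is still open. -/
theorem threshold_succ_lt {K i : ℕ} (h : IsLarge K) (hi : 1 ≤ i) (hiK : 32 * (i + 2) ≤ K) :
    threshold K (i + 1) < threshold K i := by
  rw [lt_threshold_iff h.le hi (by omega)]
  have h1 := upper_bend_pos (j := i) h (by omega)
    (threshold_bounds (i := i + 1) h (by omega) (by omega)).1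
  have h2 := gap_sub_gap K i (threshold K (i + 1))
  have h3 := (le_threshold_iff (i := i + 1) h.le (by omega) (by omega)).1 le_rfl
  have h4 : (0 : ℝ) < (K : ℝ) - (i + 1) := by
    have : ((i + 1 : ℕ) : ℝ) < K := by exact_mod_cast (show i + 1 < K by omega)
    push_cast at this; linarith
  have h5 := mul_pos h4 h1
  linarith

/-- Between two consecutive thresholds the solution is given by `phaseString`. -/
theorem isPhase_of_mem_Icc {m K i : ℕ} (h : IsLarge K) (hKm : K ≤ m + 1) (hi : 1 ≤ i)
    (hiK : 32 * (i + 2) ≤ K) {γ : ℝ} (hγ : γ ∈ Set.Icc (threshold K (i + 1)) (threshold K i)) :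
    IsPhase m K (i + 1) γ := by
  have hK := h.cast_le
  have hK2 : 0 < (K : ℝ) ^ 2 := by positivity
  have h2K : (0 : ℝ) < 2 ^ K := by positivity
  have hlo : 6 / 5 * 2 ^ K ≤ γ * (K : ℝ) ^ 2 :=
    (threshold_bounds (i := i + 1) h (by omega) (by omega)).1.trans (by gcongr; exact hγ.1)
  have hhi : γ * (K : ℝ) ^ 2 ≤ 7 / 5 * 2 ^ K :=
    le_trans (by gcongr; exact hγ.2) (threshold_bounds h hi (by omega)).2
  have hgap0 : 0 ≤ gap K i γ := (le_threshold_iff h.le hi (by omega)).1 hγ.2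
  have hgap1 : gap K (i + 1) γ ≤ 0 := (threshold_le_iff h.le (by omega) (by omega)).1 hγ.1
  have hpos : 0 < γ := by
    by_contra hcon
    have := mul_nonpos_of_nonpos_of_nonneg (not_lt.1 hcon) (sq_nonneg (K : ℝ))
    linarith
  have hsmall : ∀ l, 8 * l ≤ 7 * K → K * q l ≤ γ / 800 := by
    intro l hl
    have h1 := h.mul_q_le_param hl hlo
    linarith
  have hsmall' : ∀ l, 8 * l ≤ 7 * K → q l ≤ γ / 800 := by
    intro l hl
    have h1 := hsmall l hl
    have h2 := q_nonneg l
    nlinarith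
  have hi1 : (1 : ℝ) ≤ i := by exact_mod_cast hi
  have hiK' : 32 * ((i : ℝ) + 2) ≤ K := by exact_mod_cast hiK
  have hp : (0 : ℝ) < (K : ℝ) - (i + 1) := by linarith
  have hslope : slope K (i + 1) γ * ((K : ℝ) - (i + 1)) = pivot K γ - upper K γ (i + 1) := by
    rw [slope]; push_cast; exact div_mul_cancel₀ _ hp.ne'
  -- The signs of the two gaps say that the straight piece is a tangent: its slope lies between
  -- those of the two chords meeting at `i + 1`.
  have hslope0 : upper K γ (i + 1) - upper K γ i ≤ slope K (i + 1) γ := by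
    refine le_of_mul_le_mul_right ?_ hp
    rw [hslope]
    unfold gap at hgap0
    linarith
  have hslope1 : slope K (i + 1) γ ≤ upper K γ (i + 2) - upper K γ (i + 1) := by
    refine le_of_mul_le_mul_right ?_ hp
    rw [hslope]
    unfold gap at hgap1
    push_cast at hgap1
    linarith
  have c0 := abs_le.1 ((abs_center K i).trans_le (hsmall' i (by omega)))
  have c1 := abs_le.1 ((abs_center K (i + 1)).trans_le (hsmall' (i + 1) (by omega)))
  have hupper : 0 ≤ upper K γ (i + 1) := by
    simp only [upper]
    push_cast
    have e1 : 1 ≤ ((i : ℝ) + 1 - 1) ^ 2 := one_le_pow₀ (by linarith)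
    have e2 := mul_le_mul_of_nonneg_left e1 hpos.le
    linarith [c1.1]
  have hs0 : 0 ≤ slope K (i + 1) γ := by
    refine le_trans ?_ hslope0
    simp only [upper]
    push_cast
    have e1 : 1 ≤ ((i : ℝ) + 1 - 1) ^ 2 - ((i : ℝ) - 1) ^ 2 := by linarith
    have e2 := mul_le_mul_of_nonneg_left e1 hpos.le
    linarith [c1.1, c0.2]
  refine ⟨by omega, by omega, hKm, hpos.le, ?_, ?_, hs0, ?_, ?_⟩
  · intro j _ hjp
    exact (upper_bend_pos h (by omega) hlo).le
  · intro j hj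
    obtain rfl : j = i := by omega
    exact hslope0
  · intro j hpj hjK
    push_cast
    have hjK' : (j : ℝ) + 1 ≤ K := by exact_mod_cast hjK
    obtain ⟨l, rfl⟩ := Nat.exists_eq_add_of_le (show i + 2 ≤ j by omega)
    push_cast at hjK' ⊢
    have hl0 : (0 : ℝ) ≤ l := l.cast_nonneg
    have hL0 : 0 ≤ upper K γ (i + 1) + slope K (i + 1) γ * ((i : ℝ) + 2 + l - (i + 1)) := by
      have : 0 ≤ slope K (i + 1) γ * ((i : ℝ) + 2 + l - (i + 1)) :=
        mul_nonneg hs0 (by linarith)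
      linarith
    have hL1 : upper K γ (i + 1) + slope K (i + 1) γ * ((i : ℝ) + 2 + l - (i + 1))
        ≤ upper K γ (i + 1)
          + (upper K γ (i + 2) - upper K γ (i + 1)) * ((i : ℝ) + 2 + l - (i + 1)) := by
      have : (0 : ℝ) ≤ (i : ℝ) + 2 + l - (i + 1) := by linarith
      gcongr
    -- Near the pivot `q` is not negligible, but below `K` it is at most half the bound at `K`,
    -- hence at most 5/9 of γ K^2; and 7/8 - 1/32 = 27/32.
    have hfar : 7 * K < 8 * (i + 2 + l) → q (i + 2 + l) ≤ 5 / 9 * (γ * (K : ℝ) ^ 2) ∧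
        27 / 32 * (K : ℝ) ≤ (l : ℝ) + 1 := by
      intro hf
      constructor
      · have e1 : (2 : ℝ) ^ (i + 2 + l) * 2 ≤ 2 ^ K := by
          rw [← pow_succ]
          exact pow_le_pow_right₀ one_le_two (by omega)
        have e2 := q_le (i + 2 + l)
        linarith
      · have e1 : 7 * (K : ℝ) < 8 * ((i : ℝ) + 2 + l) := by exact_mod_cast hf
        linarith
    have hcj := abs_le.1 (abs_center K (i + 2 + l)).le
    rw [abs_le]
    constructor
    -- The line is nonnegative, so it suffices that the lower end of the tube is at most 0.
    · suffices hq : q (i + 2 + l) ≤ γ * ((i : ℝ) + 2 + l - 1) ^ 2 by linarith [hcj.2]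
      by_cases hf : 7 * K < 8 * (i + 2 + l)
      · obtain ⟨e1, e2⟩ := hfar hf
        have e3 : (27 / 32 * (K : ℝ)) ^ 2 ≤ ((i : ℝ) + 2 + l - 1) ^ 2 :=
          pow_le_pow_left₀ (by linarith) (by linarith) 2
        rw [mul_pow] at e3
        have e4 := mul_le_mul_of_nonneg_left e3 hpos.le
        have e5 := mul_pos hpos hK2
        linarith
      · have e1 := hsmall' (i + 2 + l) (by omega)
        have e2 : 1 ≤ ((i : ℝ) + 2 + l - 1) ^ 2 := one_le_pow₀ (by linarith)
        have e3 := mul_le_mul_of_nonneg_left e2 hpos.le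
        linarith
    -- At the first position after the contact the chord reaches the upper end exactly, with no
    -- slack to absorb errors, so it is treated apart.
    · rcases l with _ | l
      · push_cast at hL1 ⊢
        have e1 : upper K γ (i + 1) + slope K (i + 1) γ * ((i : ℝ) + 2 + 0 - (i + 1))
            ≤ upper K γ (i + 2) := by linarith
        refine (sub_le_sub_right e1 _).trans (le_of_eq ?_)
        simp only [upper]
        push_cast
        ring_nf
      set d : ℝ := ((l + 1 : ℕ) : ℝ) + 1 with hd
      have hd2 : 2 ≤ d := by rw [hd]; push_cast; linarith [(l.cast_nonneg : (0 : ℝ) ≤ l)]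
      have hdK : d ≤ K := by rw [hd]; linarith
      have hdj : (i : ℝ) + 2 + ((l + 1 : ℕ) : ℝ) - (i + 1) = d := by rw [hd]; ring
      rw [hdj] at hL1 ⊢
      have s1 := hsmall (i + 1) (by omega)
      have s2 := hsmall (i + 2) (by omega)
      have t1 : -center K (i + 1) * d ≤ γ / 800 := by
        have e1 := (abs_le.1 (abs_center K (i + 1)).le).1
        have e2 : -center K (i + 1) * d ≤ q (i + 1) * d := by gcongr; linarith
        have e3 : q (i + 1) * d ≤ q (i + 1) * K := by gcongr; exact q_nonneg _
        linarith
      have t2 : center K (i + 2) * d ≤ γ / 800 := by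
        have e1 := (abs_le.1 (abs_center K (i + 2)).le).2
        have e2 : center K (i + 2) * d ≤ q (i + 2) * d := by gcongr
        have e3 : q (i + 2) * d ≤ q (i + 2) * K := by gcongr; exact q_nonneg _
        linarith
      -- The prolonged chord of the parabola lies γ d (d - 1) below it at distance `d` from the
      -- contact; this margin must absorb all the centers.
      have e : upper K γ (i + 1) + (upper K γ (i + 2) - upper K γ (i + 1)) * d
          = center K (i + 1) + -center K (i + 1) * d + center K (i + 2) * d
            + γ * ((i : ℝ) + 2 + ((l + 1 : ℕ) : ℝ) - 1) ^ 2 - γ * (d * (d - 1)) := by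
        rw [hd]
        simp only [upper]
        push_cast
        ring
      suffices hq : 3 * (γ / 800) + q (i + 2 + (l + 1)) ≤ γ * (d * (d - 1)) by
        linarith [hcj.1, c1.2]
      by_cases hf : 7 * K < 8 * (i + 2 + (l + 1))
      · obtain ⟨e1, e2⟩ := hfar hf
        have e3 : 5 / 9 * (K : ℝ) ^ 2 + 3 / 800 ≤ d * (d - 1) := by
          have e5 : 27 / 32 * (K : ℝ) * (26 / 32 * K) ≤ d * (d - 1) :=
            mul_le_mul e2 (by linarith) (by linarith) (by linarith)
          have e6 : (1 : ℝ) ≤ (K : ℝ) ^ 2 := one_le_pow₀ (by linarith)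
          linarith
        have e4 := mul_le_mul_of_nonneg_left e3 hpos.le
        linarith
      · have e1 := hsmall' (i + 2 + (l + 1)) (by omega)
        have e2 : 2 * 1 ≤ d * (d - 1) :=
          mul_le_mul hd2 (by linarith) zero_le_one (by linarith)
        have e3 := mul_le_mul_of_nonneg_left e2 hpos.le
        linarith
  · intro j hKj hjm
    rcases hKj.eq_or_lt with rfl | hKj
    · have : 0 ≤ slope K (i + 1) γ * ((K : ℝ) - (i + 1)) := mul_nonneg hs0 hp.le
      change 0 ≤ pivot K γ
      linarith
    · obtain ⟨l, rfl⟩ := Nat.exists_eq_add_of_le (Nat.succ_le_of_lt hKj)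
      have e1 := two_pow_mul_sq_le (K := K) (by omega) l
      have e2 := two_pow_mul_sq_le (K := K) (by omega) (l + 1)
      have e3 := le_q (j := K.succ + l) (by omega)
      rw [show K.succ + l = K + (l + 1) by omega] at e3 ⊢
      have e4 : ((K + (l + 1) : ℕ) : ℝ) - 1 = ((K + l : ℕ) : ℝ) := by push_cast; ring
      rw [e4]
      have e5 : (2 : ℝ) ^ (K + (l + 1)) = 2 * 2 ^ (K + l) := by rw [← add_assoc, pow_succ]; ring
      have f1 : γ * ((K + l : ℕ) : ℝ) ^ 2 ≤ 7 / 5 * 2 ^ (K + l) := by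
        refine le_of_mul_le_mul_right ?_ hK2
        have := mul_le_mul_of_nonneg_right hhi (sq_nonneg ((K + l : ℕ) : ℝ))
        linarith
      have f2 : 1000 * ((K + (l + 1) : ℕ) : ℝ) ^ 2 ≤ 2 ^ (K + (l + 1)) := by
        refine le_of_mul_le_mul_right ?_ hK2
        have := mul_le_mul_of_nonneg_right h.sq_le (sq_nonneg ((K + (l + 1) : ℕ) : ℝ))
        linarith
      rw [e5] at e3 f2
      have f3 : (0 : ℝ) < 2 ^ (K + l) := by positivity
      linarith

theorem threshold_pos {K i : ℕ} (h : IsLarge K) (hi : 1 ≤ i) (hiK : 32 * (i + 1) ≤ K) :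
    0 < threshold K i :=
  div_pos (by have := (gapNum_bounds h hiK).1; have : (0 : ℝ) < 2 ^ K := by positivity
              linarith) (gapDen_pos h.le hi (by omega))

/-- The thresholds for a pivot are all smaller than those for any later pivot. -/
theorem threshold_lt_of_lt {K K' i i' : ℕ} (h : IsLarge K) (h' : IsLarge K') (hKK : K < K')
    (hi : 1 ≤ i) (hiK : 32 * (i + 1) ≤ K) (hi' : 1 ≤ i') (hiK' : 32 * (i' + 1) ≤ K') :
    threshold K i < threshold K' i' := by
  have hK := h.cast_le
  have b1 := (threshold_bounds h hi hiK).2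
  have b2 := (threshold_bounds h' hi' hiK').1
  obtain ⟨l, rfl⟩ := Nat.exists_eq_add_of_le (Nat.succ_le_of_lt hKK)
  have e1 := two_pow_mul_sq_le (K := K.succ) (by omega) l
  have hK2 : 0 < (K : ℝ) ^ 2 := by positivity
  have hK2' : 0 < ((K.succ + l : ℕ) : ℝ) ^ 2 := by positivity
  -- From 7/5 against 2 · 6/5: doubling the power of 2 outweighs the spread of the bounds and the
  -- growth of the square.
  have e2 : 7 * ((K.succ : ℕ) : ℝ) ^ 2 < 12 * (K : ℝ) ^ 2 := by push_cast; nlinarith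
  have hpow : (2 : ℝ) ^ K.succ = 2 * 2 ^ K := by rw [pow_succ]; ring
  rw [hpow] at e1
  refine lt_of_mul_lt_mul_right (a := (K : ℝ) ^ 2 * ((K.succ + l : ℕ) : ℝ) ^ 2) ?_ (by positivity)
  have f1 := mul_le_mul_of_nonneg_right b1 hK2'.le
  have f2 := mul_le_mul_of_nonneg_right b2 hK2.le
  have f3 : (2 : ℝ) ^ (K.succ + l) * (7 * ((K.succ : ℕ) : ℝ) ^ 2)
      < 2 ^ (K.succ + l) * (12 * (K : ℝ) ^ 2) := by gcongr
  linarith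

end Thresholds

end WeightedFusedLasso

namespace WeightedFusedLasso

/-! ### Locating and counting the events. -/

section Count

theorem threshold_lt_of_index_lt {K i i' : ℕ} (h : IsLarge K) (hi : 1 ≤ i) (hii : i < i')
    (hiK : 32 * (i' + 1) ≤ K) : threshold K i' < threshold K i := by
  induction i', hii using Nat.le_induction with
  | base => exact threshold_succ_lt h hi (by omega)
  | succ l hl ih => exact (threshold_succ_lt h (by omega) (by omega)).trans (ih (by omega))

theorem upper_sub_lt_slope {K i : ℕ} (hiK : i + 1 < K) {γ : ℝ} (h : 0 < gap K i γ) :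
    upper K γ (i + 1) - upper K γ i < slope K (i + 1) γ := by
  have hp : (0 : ℝ) < (K : ℝ) - ((i + 1 : ℕ) : ℝ) := sub_pos.2 (by exact_mod_cast hiK)
  rw [slope, lt_div_iff₀ hp]
  unfold gap at h
  push_cast
  linarith

theorem jump_ne_zero_of_mem_Ico {m K i : ℕ} (h : IsLarge K) (hKm : K ≤ m + 1) (hi : 1 ≤ i)
    (hiK : 32 * (i + 2) ≤ K) {γ : ℝ} (hγ : γ ∈ Set.Ico (threshold K (i + 1)) (threshold K i))
    (t : Fin m) (ht : (t : ℕ) + 1 = i) :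
    jump (solutionPath (quadWeights m) (zigzagInput m) γ) t ≠ 0 :=
  jump_ne_zero_of_isPhase (isPhase_of_mem_Icc h hKm hi hiK ⟨hγ.1, hγ.2.le⟩)
    (upper_sub_lt_slope (by omega) ((lt_threshold_iff h.le hi (by omega)).1 hγ.2)) t ht

theorem jump_eq_zero_of_mem_Icc {m K i : ℕ} (h : IsLarge K) (hKm : K ≤ m + 1) (hi : 1 ≤ i)
    (hiK : 32 * (i + 2) ≤ K) {γ : ℝ} (hγ : γ ∈ Set.Icc (threshold K (i + 1)) (threshold K i))
    (t : Fin m) (ht : (t : ℕ) = i) :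
    jump (solutionPath (quadWeights m) (zigzagInput m) γ) t = 0 :=
  jump_eq_zero_of_isPhase (isPhase_of_mem_Icc h hKm hi hiK hγ) (by omega) t (by omega)

/-- At this parameter the last contact passes from `i + 2` to `i + 1`, and jump `t` is the bend of
the string at `t + 2`. -/
theorem threshold_mem_fuseEvents {m K i : ℕ} (h : IsLarge K) (hKm : K ≤ m + 1) (hi : 1 ≤ i)
    (hiK : 32 * (i + 3) ≤ K) (t : Fin m) (ht : (t : ℕ) = i) :
    (t, threshold K (i + 1)) ∈ fuseEvents (solutionPath (quadWeights m) (zigzagInput m)) := by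
  refine ⟨threshold_pos h (by omega) (by omega), ?_, ?_⟩
  · filter_upwards [Ico_mem_nhdsLT (threshold_succ_lt (i := i + 1) h (by omega) (by omega))]
      with s hs
    exact sub_ne_zero.1
      (jump_ne_zero_of_mem_Ico (i := i + 1) h hKm (by omega) (by omega) hs t (by omega))
  · filter_upwards [Icc_mem_nhdsGE (threshold_succ_lt (i := i) h hi (by omega))] with s hs
    exact sub_eq_zero.1 (jump_eq_zero_of_mem_Icc h hKm hi (by omega) hs t ht)

/-- In phase `K` with last contact `i + 1` the bend at `i + 2` is gone; in phase `K + 1` with last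
contact `i + 2` it is back. -/
theorem exists_mem_unfuseEvents {m K i : ℕ} (h : IsLarge K) (hKm : K ≤ m) (hi : 1 ≤ i)
    (hiK : 32 * (i + 3) ≤ K) (t : Fin m) (ht : (t : ℕ) = i) :
    ∃ e, threshold K i ≤ e ∧ e < threshold (K + 1) (i + 1) ∧
      (t, e) ∈ unfuseEvents (solutionPath (quadWeights m) (zigzagInput m)) := by
  have h' : IsLarge (K + 1) := isLarge_of_le (h.le.trans (by omega))
  have hlt := threshold_succ_lt (i := i + 1) h' (by omega) (by omega)
  obtain ⟨e, he, hec, hmem⟩ := exists_unfuseEvent (quadWeights_nonneg m) (zigzagInput m)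
    (threshold_pos (i := i + 1) h (by omega) (by omega)).le (threshold_succ_lt h hi (by omega))
    (threshold_lt_of_lt (i' := i + 2) h h' (by omega) hi (by omega) (by omega) (by omega)).le t
    (fun s hs => jump_eq_zero_of_mem_Icc h (by omega) hi (by omega) hs t ht)
    (jump_ne_zero_of_mem_Ico (i := i + 1) h' (by omega) (by omega) (by omega) ⟨le_rfl, hlt⟩ t
      (by omega))
  exact ⟨e, he, hec.trans hlt, hmem⟩

theorem eq_of_threshold_eq {K K' i i' : ℕ} (h : IsLarge K) (h' : IsLarge K') (hi : 1 ≤ i)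
    (hiK : 32 * (i + 1) ≤ K) (hi' : 1 ≤ i') (hiK' : 32 * (i' + 1) ≤ K')
    (he : threshold K i = threshold K' i') : K = K' ∧ i = i' := by
  have hK : K = K' := by
    rcases lt_trichotomy K K' with hlt | heq | hlt
    · exact absurd he (threshold_lt_of_lt h h' hlt hi hiK hi' hiK').ne
    · exact heq
    · exact absurd he (threshold_lt_of_lt h' h hlt hi' hiK' hi hiK).ne'
  subst hK
  refine ⟨rfl, ?_⟩
  rcases lt_trichotomy i i' with hlt | heq | hlt
  · exact absurd he (threshold_lt_of_index_lt h hi hlt hiK').ne'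
  · exact heq
  · exact absurd he (threshold_lt_of_index_lt h hi' hlt hiK).ne

/-- A relation replaces an injection because the un-fuse times are only confined to windows, not
computed. -/
theorem card_le_ncard_of_relation {ι β : Type*} {S : Finset ι} {T : Set β} (hT : T.Finite)
    (R : ι → β → Prop) (hex : ∀ a ∈ S, ∃ b ∈ T, R a b)
    (hinj : ∀ a ∈ S, ∀ a' ∈ S, ∀ b, R a b → R a' b → a = a') : S.card ≤ T.ncard := by
  classical
  rw [Set.ncard_eq_toFinset_card T hT]
  refine Finset.card_le_card_of_forall_subsingleton R (fun a ha => ?_) fun b _ => ?_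
  · obtain ⟨b, hb, hab⟩ := hex a ha
    exact ⟨b, hT.mem_toFinset.2 hb, hab⟩
  · intro a ha a' ha'
    exact hinj a ha.1 a' ha'.1 b ha.2 ha'.2

/-- Pairs of a pivot and an index, quadratically many in `n`. -/
def eventIndices (n : ℕ) : Finset (ℕ × ℕ) :=
  Finset.Ico (64 * (n / 128)) n ×ˢ Finset.Ico 1 (n / 128 + 1)

theorem card_eventIndices {n : ℕ} (hn : 640 ≤ n) :
    1 / 1024 * (n : ℝ) ^ 2 ≤ ((eventIndices n).card : ℝ) := by
  have h1 : (eventIndices n).card = (n - 64 * (n / 128)) * (n / 128) := by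
    simp [eventIndices]
  have h2 : n ≤ 2 * (n - 64 * (n / 128)) := by omega
  have h3 : n ≤ 512 * (n / 128) := by omega
  have h4 : n * n ≤ 1024 * (eventIndices n).card := by
    rw [h1]
    calc n * n ≤ 2 * (n - 64 * (n / 128)) * (512 * (n / 128)) := Nat.mul_le_mul h2 h3
      _ = _ := by ring
  have h5 : (n : ℝ) * n ≤ 1024 * ((eventIndices n).card : ℝ) := by exact_mod_cast h4
  linarith

theorem of_mem_eventIndices {m : ℕ} (hm : 640 ≤ m + 1) {a : ℕ × ℕ}
    (ha : a ∈ eventIndices (m + 1)) :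
    IsLarge a.1 ∧ a.1 ≤ m ∧ 1 ≤ a.2 ∧ 32 * (a.2 + 3) ≤ a.1 ∧ a.2 < m := by
  simp only [eventIndices, Finset.mem_product, Finset.mem_Ico] at ha
  -- From `640 ≤ m + 1` the quotient by 128 is at least 5, which gives a pivot of at least 320 and
  -- room for `32 * (a.2 + 3)`.
  exact ⟨isLarge_of_le (by omega), by omega, by omega, by omega, by omega⟩

theorem card_le_ncard_fuseEvents {m : ℕ} (hm : 640 ≤ m + 1) : (eventIndices (m + 1)).card
    ≤ (fuseEvents (solutionPath (quadWeights m) (zigzagInput m))).ncard := by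
  refine card_le_ncard_of_relation (finite_fuseEvents (quadWeights_nonneg m) _)
    (fun a p => p.2 = threshold a.1 (a.2 + 1)) (fun a ha => ?_) fun a ha a' ha' p hp hp' => ?_
  · obtain ⟨h1, h2, h3, h4, h5⟩ := of_mem_eventIndices hm ha
    exact ⟨_, threshold_mem_fuseEvents h1 (by omega) h3 h4 ⟨a.2, h5⟩ rfl, rfl⟩
  · obtain ⟨h1, h2, h3, h4, h5⟩ := of_mem_eventIndices hm ha
    obtain ⟨h1', h2', h3', h4', h5'⟩ := of_mem_eventIndices hm ha'
    obtain ⟨e1, e2⟩ := eq_of_threshold_eq (i := a.2 + 1) (i' := a'.2 + 1) h1 h1' (by omega)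
      (by omega) (by omega) (by omega) (hp.symm.trans hp')
    exact Prod.ext e1 (by omega)

theorem card_le_ncard_criticalValues {m : ℕ} (hm : 640 ≤ m + 1) : (eventIndices (m + 1)).card
    ≤ (criticalValues (solutionPath (quadWeights m) (zigzagInput m))).ncard := by
  refine card_le_ncard_of_relation (finite_criticalValues (quadWeights_nonneg m) _)
    (fun a γ => γ = threshold a.1 (a.2 + 1)) (fun a ha => ?_) fun a ha a' ha' p hp hp' => ?_
  · obtain ⟨h1, h2, h3, h4, h5⟩ := of_mem_eventIndices hm ha
    exact ⟨_, fuseEvent_mem_criticalValues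
      (threshold_mem_fuseEvents h1 (by omega) h3 h4 ⟨a.2, h5⟩ rfl), rfl⟩
  · obtain ⟨h1, h2, h3, h4, h5⟩ := of_mem_eventIndices hm ha
    obtain ⟨h1', h2', h3', h4', h5'⟩ := of_mem_eventIndices hm ha'
    obtain ⟨e1, e2⟩ := eq_of_threshold_eq (i := a.2 + 1) (i' := a'.2 + 1) h1 h1' (by omega)
      (by omega) (by omega) (by omega) (hp.symm.trans hp')
    exact Prod.ext e1 (by omega)

theorem card_le_ncard_unfuseEvents {m : ℕ} (hm : 640 ≤ m + 1) : (eventIndices (m + 1)).card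
    ≤ (unfuseEvents (solutionPath (quadWeights m) (zigzagInput m))).ncard := by
  -- For a fixed index the window of a pivot ends before that of any later pivot begins, so an event
  -- determines its pivot.
  have hord : ∀ {K K' i : ℕ}, IsLarge K → IsLarge K' → K < K' → 1 ≤ i → 32 * (i + 3) ≤ K →
      threshold (K + 1) (i + 1) ≤ threshold K' i := by
    intro K K' i h h' hKK hi hiK
    have h1 : IsLarge (K + 1) := isLarge_of_le (h.le.trans (by omega))
    rcases (show K + 1 = K' ∨ K + 1 < K' by omega) with rfl | hlt
    · exact (threshold_succ_lt h' hi (by omega)).le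
    · exact (threshold_lt_of_lt h1 h' hlt (by omega) (by omega) hi (by omega)).le
  refine card_le_ncard_of_relation (finite_unfuseEvents (quadWeights_nonneg m) _)
    (fun a p => (p.1 : ℕ) = a.2 ∧ threshold a.1 a.2 ≤ p.2 ∧ p.2 < threshold (a.1 + 1) (a.2 + 1))
    (fun a ha => ?_) ?_
  · obtain ⟨h1, h2, h3, h4, h5⟩ := of_mem_eventIndices hm ha
    obtain ⟨e, he, he', hmem⟩ := exists_mem_unfuseEvents h1 h2 h3 h4 ⟨a.2, h5⟩ rfl
    exact ⟨_, hmem, rfl, he, he'⟩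
  · rintro ⟨K, i⟩ ha ⟨K', i'⟩ ha' ⟨t, γ⟩ ⟨ht, hl, hu⟩ ⟨ht', hl', hu'⟩
    obtain ⟨h1, h2, h3, h4, h5⟩ := of_mem_eventIndices hm ha
    obtain ⟨h1', h2', h3', h4', h5'⟩ := of_mem_eventIndices hm ha'
    simp only at *
    obtain rfl : i = i' := ht.symm.trans ht'
    rcases lt_trichotomy K K' with hlt | rfl | hlt
    · exact absurd ((hord h1 h1' hlt h3 h4).trans hl') (not_le.2 hu)
    · rfl
    · exact absurd ((hord h1' h1 hlt h3 h4').trans hl) (not_le.2 hu')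

theorem tildeWeights_quadWeights (m : ℕ) (i : Fin (m + 1)) :
    tildeWeights (quadWeights m) i.castSucc = (((i : ℕ) + 1 : ℝ) - 1) ^ 2 := by
  refine Fin.cases ?_ (fun k => ?_) i
  · simp [tildeWeights]
  · rw [tildeWeights, ← Fin.succ_castSucc, Fin.cons_succ, Fin.snoc_castSucc]
    simp [quadWeights]

theorem tildeWeights_last {m : ℕ} (α : Fin m → ℝ) : tildeWeights α (Fin.last (m + 1)) = 0 := by
  rw [tildeWeights, ← Fin.succ_last, Fin.cons_succ, Fin.snoc_last]

theorem tildeInput_zigzagInput (m : ℕ) (i : Fin (m + 2)) :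
    tildeInput (zigzagInput m) i = height m (i + 1) := by
  have hlast : height m (m + 2) = 0 := by simp [height]
  have h1 : ∑ t : Fin (m + 1), (if i ≤ t.castSucc then zigzagInput m t else 0)
      = ∑ t ∈ Finset.range (m + 1),
          if (i : ℕ) ≤ t then height m (t + 2) - height m (t + 1) else 0 := by
    rw [Finset.sum_range]
    rfl
  have h2 : ∀ n, (i : ℕ) ≤ n → (∑ t ∈ Finset.range n,
      if (i : ℕ) ≤ t then height m (t + 2) - height m (t + 1) else 0)
      = height m (n + 1) - height m (i + 1) := by
    intro n hn
    induction n, hn using Nat.le_induction with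
    | base =>
      rw [sub_self]
      exact Finset.sum_eq_zero fun t ht => if_neg (not_le.2 (Finset.mem_range.1 ht))
    | succ n hn ih =>
      rw [Finset.sum_range_succ, ih, if_pos hn]
      ring
  rw [tildeInput, h1, h2 _ (by omega), hlast]
  ring

end Count

end WeightedFusedLasso

theorem theorem4 :
    ∃ c : ℝ, 0 < c ∧ ∃ N : ℕ, ∀ m : ℕ, N ≤ m + 1 →
      ∃ (α : Fin m → ℝ) (y : Fin (m + 1) → ℝ),
        (∀ t, 0 ≤ α t) ∧
        (∀ i : Fin (m + 1),
          WeightedFusedLasso.tildeWeights α i.castSucc = (((i : ℕ) + 1 : ℝ) - 1) ^ 2) ∧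
        WeightedFusedLasso.tildeWeights α (Fin.last (m + 1)) = 0 ∧
        (∀ i : Fin (m + 1), WeightedFusedLasso.tildeInput y i.castSucc =
          (-1) ^ ((i : ℕ) + 1) * WeightedFusedLasso.q ((i : ℕ) + 1)) ∧
        WeightedFusedLasso.tildeInput y (Fin.last (m + 1)) = 0 ∧
        c * ((m + 1 : ℕ) : ℝ) ^ 2 ≤
          (WeightedFusedLasso.segmentCount (WeightedFusedLasso.solutionPath α y) : ℝ) ∧
        c * ((m + 1 : ℕ) : ℝ) ^ 2 ≤
          ((WeightedFusedLasso.fuseEvents (WeightedFusedLasso.solutionPath α y)).ncard : ℝ) ∧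
        c * ((m + 1 : ℕ) : ℝ) ^ 2 ≤
          ((WeightedFusedLasso.unfuseEvents (WeightedFusedLasso.solutionPath α y)).ncard : ℝ) := by
  refine ⟨1 / 1024, by norm_num, 640, fun m hm => ⟨WeightedFusedLasso.quadWeights m,
    WeightedFusedLasso.zigzagInput m, WeightedFusedLasso.quadWeights_nonneg m,
    WeightedFusedLasso.tildeWeights_quadWeights m, WeightedFusedLasso.tildeWeights_last _,
    fun i => ?_, ?_, ?_, ?_, ?_⟩⟩
  · rw [WeightedFusedLasso.tildeInput_zigzagInput, WeightedFusedLasso.height,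
      if_pos (by simp; omega)]
    simp
  · rw [WeightedFusedLasso.tildeInput_zigzagInput, WeightedFusedLasso.height, if_neg (by simp)]
  · refine (WeightedFusedLasso.card_eventIndices hm).trans (Nat.cast_le.2 ?_)
    exact (WeightedFusedLasso.card_le_ncard_criticalValues hm).trans (Nat.le_succ _)
  · exact (WeightedFusedLasso.card_eventIndices hm).trans
      (Nat.cast_le.2 (WeightedFusedLasso.card_le_ncard_fuseEvents hm))
  · exact (WeightedFusedLasso.card_eventIndices hm).trans
      (Nat.cast_le.2 (WeightedFusedLasso.card_le_ncard_unfuseEvents hm))
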